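/- **Theorem (Security of mOPED with deterministic encryption).** Let $(\mathsf{KeyGen},\mathsf{DET},\mathsf{Dec})$ be a deterministic encryption scheme: for each security parameter $\kappa$, $\mathsf{KeyGen}(1^\kappa)$ is a distribution on keys $K$, $\mathsf{DET}(K,\cdot)$ maps $M_\kappa=\{0,\dots,2^{\ell(\kappa)}-1\}$ to $\{0,\dots,2^{c(\kappa)}-1\}$, and $\mathsf{Dec}(K,\mathsf{DET}(K,x))=x$ for all $x\in M_\kappa$. A function $f:\mathbb N\to\mathbb R$ is *negligible* if for every $c\in\mathbb N$ there is $K$ with $f(\kappa)<\kappa^{-c}$ for all $\kappa>K$. Assume that $\mathsf{DET}$ is a pseudorandom function: for every probabilistic polynomial-time (ppt) $\mathcal B$ with input $1^\kappa$, the absolute difference between the probabilities that $\mathcal B$ outputs $1$ with oracle $\mathsf{DET}(K,\cdot)$, $K\leftarrow\mathsf{KeyGen}(1^\kappa)$, and with oracle a uniformly random function from $M_\kappa$ to $\{0,\dots,2^{c(\kappa)}-1\}$, is negligible in $\kappa$. For sequences $\vec u,\vec v$ of integers and a set $D$ of integers write $\mathrm{EDD}(\vec u,\vec v,D)$ if $|\vec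 u|=|\vec v|$ and, for all $d,d'\in D$ and all $i,j$, $\vec u[i]+d\ge\vec u[j]+d'\iff\vec v[i]+d\ge\vec v[j]+d'$. The mOPED encoding $e\mathcal T$ is a balanced (AVL) binary search tree of ciphertexts, ordered by their plaintexts and kept by an honest-but-curious cloud. To insert $x$, the client sends $\mathsf{DET}(K,x)$; the cloud walks down from the root, at each node sending the ciphertext stored there to the client, who decrypts it and answers whether $x$ is smaller than, equal to or larger than its plaintext; on "equal" nothing is inserted, otherwise the ciphertext is put at the leaf reached and the tree is rebalanced. *The IND-CDDA game* between a client and an adaptive ppt adversary $\mathsf{Adv}$ with input $1^\kappa$: 1. The client draws $K\leftarrow\mathsf{KeyGen}(1^\kappa)$ and a uniformly random bit $b$, and $e\mathcal T$ is empty. 2. $\mathsf{Adv}$ sends a finite set of integers $D=\{d_1,\dots,d_n\}$. 3. There follow polynomially many rounds. In round $j$, $\mathsf{Adv}$ sends integers $v^0_j,v^1_j$ such that $v^a_j$ and all $v^a_j+d_i$ lie in $M_\kappa$ for $a=0,1$ (other pairs are refused and are not a round). The client inserts $v^b_j,v^b_j+d_1,\dots,v^b_j+d_n$ into $e\mathcal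 T$, one after the other. $\mathsf{Adv}$ sees all messages exchanged between client and cloud and the state of the cloud after each insertion. 4. $\mathsf{Adv}$ outputs a bit $b'$. $\mathsf{Adv}$ wins if $b'=b$ and $\mathrm{EDD}\big((v^0_j)_j,(v^1_j)_j,D\cup\{0\}\big)$ holds, where $j$ runs over all rounds played. Then mOPED is IND-CDDA secure: for every ppt adversary $\mathsf{Adv}$ there is a negligible function $\mathsf{negl}$ such that for all $\kappa$ $$\Pr[\mathsf{Adv}\text{ wins}]\le\tfrac12+\mathsf{negl}(\kappa),$$ where the probability is over the coins of $\mathsf{Adv}$, the key and the bit $b$. -/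

import Mathlib

namespace MOPED

/-! ## Negligible functions -/

/-- `f` is negligible: for every `c` it is eventually smaller than `κ ^ (-c)`. -/
def Negligible (f : ℕ → ℝ) : Prop :=
  ∀ c : ℕ, ∃ K : ℕ, ∀ κ : ℕ, K < κ → f κ < (κ : ℝ) ^ (-(c : ℤ))

/-! ## A machine model with a step count

Probabilistic interactive programs: structured `while` programs over finitely many registers that
hold data built from `nil`, integers and pairs (`nil` is the truth value "false").  One command
is one step.  Addition, subtraction and comparison are the only arithmetic, so in `t` steps the
integers grow by `O(t)` bits and the (shared) data by `O(t)` cells; hence polynomially many steps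
of such a program are polynomial time on a Turing machine, and conversely. -/

/-- The data that programs work on, and the messages that they exchange. -/
inductive Val : Type
  | nil : Val
  | int (z : ℤ) : Val
  | pair (a b : Val) : Val

namespace Val

/-- First component (`nil` if there is none). -/
def fst : Val → Val
  | pair a _ => a
  | _ => nil

/-- Second component (`nil` if there is none). -/
def snd : Val → Val
  | pair _ b => b
  | _ => nil

/-- The integer held by an atom (`0` for anything else). -/
def toInt : Val → ℤ
  | int z => z
  | _ => 0

/-- Truth: everything but `nil`. -/
def truth : Val → Bool
  | nil => false
  | _ => true

/-- A truth value as data. -/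
def ofBool (b : Bool) : Val := if b then int 1 else nil

/-- A list as data: nested pairs ending in `nil`. -/
def ofList {α : Type} (f : α → Val) : List α → Val
  | [] => nil
  | a :: l => pair (f a) (ofList f l)

/-- Reading data as a list of integers. -/
def toIntList : Val → List ℤ
  | pair a b => a.toInt :: toIntList b
  | _ => []

end Val

/-- Expressions, evaluated in one step. -/
inductive Expr : Type
  | var (x : ℕ) : Expr
  | nil : Expr
  | lit (z : ℤ) : Expr
  | pair (e₁ e₂ : Expr) : Expr
  | fst (e : Expr) : Expr
  | snd (e : Expr) : Expr
  | add (e₁ e₂ : Expr) : Expr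
  | sub (e₁ e₂ : Expr) : Expr
  | le (e₁ e₂ : Expr) : Expr
  | isInt (e : Expr) : Expr
  | isPair (e : Expr) : Expr

/-- The contents of the registers. -/
abbrev Store : Type := ℕ → Val

/-- The value of an expression. -/
def Expr.eval (s : Store) : Expr → Val
  | var x => s x
  | nil => Val.nil
  | lit z => Val.int z
  | pair e₁ e₂ => Val.pair (e₁.eval s) (e₂.eval s)
  | fst e => (e.eval s).fst
  | snd e => (e.eval s).snd
  | add e₁ e₂ => Val.int ((e₁.eval s).toInt + (e₂.eval s).toInt)
  | sub e₁ e₂ => Val.int ((e₁.eval s).toInt - (e₂.eval s).toInt)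
  | le e₁ e₂ => Val.ofBool (decide ((e₁.eval s).toInt ≤ (e₂.eval s).toInt))
  | isInt e => match e.eval s with
    | Val.int _ => Val.ofBool true
    | _ => Val.ofBool false
  | isPair e => match e.eval s with
    | Val.pair _ _ => Val.ofBool true
    | _ => Val.ofBool false

/-- Commands.  `toss x` puts a fair coin toss into register `x`; `send x e` sends the value
of `e` to the other party and puts the reply into register `x`. -/
inductive Cmd : Type
  | skip : Cmd
  | assign (x : ℕ) (e : Expr) : Cmd
  | seq (c₁ c₂ : Cmd) : Cmd
  | ite (e : Expr) (c₁ c₂ : Cmd) : Cmd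
  | loop (e : Expr) (c : Cmd) : Cmd
  | toss (x : ℕ) : Cmd
  | send (x : ℕ) (e : Expr) : Cmd

/-- A configuration: the commands still to be executed and the registers. -/
structure Config : Type where
  todo : List Cmd
  store : Store

/-- What a configuration does next. -/
inductive Action : Type
  | halt : Action
  | tau (c : Config) : Action
  | toss (k : Bool → Config) : Action
  | send (m : Val) (k : Val → Config) : Action

/-- One step.  `loop e c` executes `c` as long as `e` is true. -/
def Config.next : Config → Action
  | ⟨[], _⟩ => Action.halt
  | ⟨Cmd.skip :: k, s⟩ => Action.tau ⟨k, s⟩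
  | ⟨Cmd.assign x e :: k, s⟩ => Action.tau ⟨k, Function.update s x (e.eval s)⟩
  | ⟨Cmd.seq c₁ c₂ :: k, s⟩ => Action.tau ⟨c₁ :: c₂ :: k, s⟩
  | ⟨Cmd.ite e c₁ c₂ :: k, s⟩ =>
      Action.tau ⟨(if (e.eval s).truth then c₁ else c₂) :: k, s⟩
  | ⟨Cmd.loop e c :: k, s⟩ =>
      Action.tau ⟨if (e.eval s).truth then c :: Cmd.loop e c :: k else k, s⟩
  | ⟨Cmd.toss x :: k, s⟩ =>
      Action.toss fun b => ⟨k, Function.update s x (Val.ofBool b)⟩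
  | ⟨Cmd.send x e :: k, s⟩ =>
      Action.send (e.eval s) fun r => ⟨k, Function.update s x r⟩

/-- From `c`, the program halts after at most `n` steps, whatever the coin tosses
and whatever the replies that it receives. -/
def Config.HaltsWithin : ℕ → Config → Prop
  | 0, c => c.next = Action.halt
  | n + 1, c => match c.next with
    | Action.halt => True
    | Action.tau c' => HaltsWithin n c'
    | Action.toss k => ∀ b, HaltsWithin n (k b)
    | Action.send _ k => ∀ r, HaltsWithin n (k r)

/-- The start of a program on input `1 ^ κ`: register `0` holds `κ`, all others are empty.
(Time is measured in the number `κ`, not in its length.) -/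
def Cmd.start (p : Cmd) (κ : ℕ) : Config :=
  ⟨[p], fun x => if x = 0 then Val.int κ else Val.nil⟩

/-- Probabilistic polynomial-time interactive programs: the number of steps on input `1 ^ κ` is at
most a polynomial in `κ`, whatever happens. -/
structure PPT : Type where
  prog : Cmd
  time : Polynomial ℕ
  halts : ∀ κ : ℕ, (prog.start κ).HaltsWithin (time.eval κ)

/-- A fair coin. -/
noncomputable def coin : PMF Bool := PMF.uniformOfFintype Bool

/-- Run a program for at most `n` steps against a party with internal state `σ` that answers the
message `m` in state `s` by `O s m = (reply, new state)`.  The result is the output bit of the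
program (the truth of register `0` at the end) and the final state of the party. -/
noncomputable def Config.run {σ : Type} (O : σ → Val → Val × σ) :
    ℕ → Config → σ → PMF (Bool × σ)
  | 0, c, s => PMF.pure ((c.store 0).truth, s)
  | n + 1, c, s => match c.next with
    | Action.halt => PMF.pure ((c.store 0).truth, s)
    | Action.tau c' => Config.run O n c' s
    | Action.toss k => coin.bind fun b => Config.run O n (k b) s
    | Action.send m k => Config.run O n (k (O s m).1) (O s m).2

/-- Run a polynomial-time program to its end, on input `1 ^ κ`. -/
noncomputable def PPT.run (A : PPT) (κ : ℕ) {σ : Type} (O : σ → Val → Val × σ) (s : σ) :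
    PMF (Bool × σ) :=
  (A.prog.start κ).run O (A.time.eval κ) s

/-! ## Deterministic encryption and pseudorandomness -/

/-- A deterministic encryption scheme: for security parameter `κ` it encrypts
`msgLen κ`-bit numbers to `ctLen κ`-bit numbers. -/
structure DetEncScheme : Type 1 where
  Key : ℕ → Type
  msgLen : ℕ → ℕ
  ctLen : ℕ → ℕ
  keyGen : (κ : ℕ) → PMF (Key κ)
  enc : (κ : ℕ) → Key κ → Fin (2 ^ msgLen κ) → Fin (2 ^ ctLen κ)
  dec : (κ : ℕ) → Key κ → Fin (2 ^ ctLen κ) → Fin (2 ^ msgLen κ)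
  dec_enc : ∀ (κ : ℕ) (k : Key κ) (m : Fin (2 ^ msgLen κ)), dec κ k (enc κ k m) = m

/-- An integer as an `n`-bit message, if it is one. -/
def toMsg (n : ℕ) (z : ℤ) : Option (Fin (2 ^ n)) :=
  if h : 0 ≤ z ∧ z.toNat < 2 ^ n then some ⟨z.toNat, h.2⟩ else none

/-- Oracle access to `f`; queries outside the domain of `f` are answered by `nil`. -/
def funOracle {n l : ℕ} (f : Fin (2 ^ n) → Fin (2 ^ l)) : Unit → Val → Val × Unit :=
  fun _ q => match q with
    | Val.int z => match toMsg n z with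
      | some m => (Val.int ((f m : ℕ) : ℤ), ())
      | none => (Val.nil, ())
    | _ => (Val.nil, ())

namespace DetEncScheme

/-- The probability that `A` outputs `1` with oracle access to encryption under a random key. -/
noncomputable def prReal (E : DetEncScheme) (A : PPT) (κ : ℕ) : ℝ :=
  (((E.keyGen κ).bind fun k => (A.run κ (funOracle (E.enc κ k)) ()).map Prod.fst) true).toReal

/-- The probability that `A` outputs `1` with oracle access to a uniformly random function. -/
noncomputable def prIdeal (E : DetEncScheme) (A : PPT) (κ : ℕ) : ℝ :=
  (((PMF.uniformOfFintype (Fin (2 ^ E.msgLen κ) → Fin (2 ^ E.ctLen κ))).bind fun f =>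
    (A.run κ (funOracle f) ()).map Prod.fst) true).toReal

/-- Encryption is a pseudorandom function. -/
def IsPRF (E : DetEncScheme) : Prop :=
  ∀ A : PPT, Negligible fun κ => |E.prReal A κ - E.prIdeal A κ|

end DetEncScheme

/-! ## The balanced search tree over ciphertexts kept by the cloud -/

/-- Binary search trees over ciphertexts, with the height stored at each node.  The order-preserving
encoding of a ciphertext is the path from the root to it. -/
inductive STree (C : Type) : Type
  | leaf : STree C
  | node (h : ℕ) (l : STree C) (c : C) (r : STree C) : STree C

namespace STree

variable {C : Type}

/-- The (stored) height. -/
def height : STree C → ℕ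
  | leaf => 0
  | node h _ _ _ => h

/-- A node with the right height. -/
def mk (l : STree C) (c : C) (r : STree C) : STree C :=
  node (max l.height r.height + 1) l c r

/-- A node whose subtrees may differ in height by two, rebalanced by the AVL rotations. -/
def balance (l : STree C) (c : C) (r : STree C) : STree C :=
  if r.height + 1 < l.height then
    match l with
    | leaf => mk l c r
    | node _ ll lc lr =>
      if lr.height ≤ ll.height then mk ll lc (mk lr c r)
      else match lr with
        | leaf => mk l c r
        | node _ a x b => mk (mk ll lc a) x (mk b c r)
  else if l.height + 1 < r.height then
    match r with
    | leaf => mk l c r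
    | node _ rl rc rr =>
      if rl.height ≤ rr.height then mk (mk l c rl) rc rr
      else match rl with
        | leaf => mk l c r
        | node _ a x b => mk (mk l c a) x (mk b rc rr)
  else mk l c r

/-- A tree as data. -/
def toVal (f : C → Val) : STree C → Val
  | leaf => Val.nil
  | node h l c r => Val.pair (Val.int h) (Val.pair (f c) (Val.pair (l.toVal f) (r.toVal f)))

end STree

/-- The messages of the insertion protocol: the client asks to insert a ciphertext; the cloud shows
the client the ciphertext at the current node; the client answers how the new value compares with
the plaintext of that ciphertext. -/
inductive Message (C : Type) : Type
  | insert (c : C) : Message C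
  | reveal (c : C) : Message C
  | answer (o : Ordering) : Message C

/-- A comparison result as data. -/
def orderingVal : Ordering → Val
  | Ordering.lt => Val.int (-1)
  | Ordering.eq => Val.int 0
  | Ordering.gt => Val.int 1

/-- A message as data. -/
def Message.toVal {C : Type} (f : C → Val) : Message C → Val
  | insert c => Val.pair (Val.int 0) (f c)
  | reveal c => Val.pair (Val.int 1) (f c)
  | answer o => Val.pair (Val.int 2) (orderingVal o)

/-- The walk down the tree that inserts `c`, where `ans` is the client: the new tree,
and the messages exchanged.  A ciphertext that is found is not inserted again. -/
def STree.walk {C : Type} (ans : C → Ordering) (c : C) : STree C → STree C × List (Message C)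
  | .leaf => (.mk .leaf c .leaf, [])
  | .node h l c' r => match ans c' with
    | .lt => (.balance (l.walk ans c).1 c' r,
        .reveal c' :: .answer .lt :: (l.walk ans c).2)
    | .eq => (.node h l c' r, [.reveal c', .answer .eq])
    | .gt => (.balance l c' (r.walk ans c).1,
        .reveal c' :: .answer .gt :: (r.walk ans c).2)

namespace DetEncScheme

variable (E : DetEncScheme) {κ : ℕ}

/-- The ciphertexts for security parameter `κ`. -/
abbrev Ct (E : DetEncScheme) (κ : ℕ) : Type := Fin (2 ^ E.ctLen κ)

/-- The client with key `k` inserts `m`: it encrypts `m`, and it answers by decrypting what the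
cloud shows and comparing `m` with the result. -/
def insert (k : E.Key κ) (m : Fin (2 ^ E.msgLen κ)) (t : STree (E.Ct κ)) :
    STree (E.Ct κ) × List (Message (E.Ct κ)) :=
  let res := t.walk (fun c' => compare m (E.dec κ k c')) (E.enc κ k m)
  (res.1, Message.insert (E.enc κ k m) :: res.2)

/-- Insertion of several messages, one after the other: the final tree, and for each insertion the
messages exchanged and the tree after it. -/
def insertAll (k : E.Key κ) : List (Fin (2 ^ E.msgLen κ)) → STree (E.Ct κ) →
    STree (E.Ct κ) × List (List (Message (E.Ct κ)) × STree (E.Ct κ))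
  | [], t => (t, [])
  | m :: ms, t =>
    let one := E.insert k m t
    let rest := insertAll k ms one.1
    (rest.1, (one.2, one.1) :: rest.2)

end DetEncScheme

/-! ## The game -/

/-- Two sequences of timestamps are equal up to distances with displacements `D`. -/
def EDD (u v : List ℤ) (D : Set ℤ) : Prop :=
  ∃ h : u.length = v.length, ∀ d ∈ D, ∀ d' ∈ D, ∀ i j : Fin u.length,
    (u.get i + d ≥ u.get j + d' ↔ v.get (i.cast h) + d ≥ v.get (j.cast h) + d')

/-- The state of the game: the displacements (once they are chosen), the pairs of timestamps
chosen so far, in order, and the tree on the cloud. -/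
structure GameState (C : Type) : Type where
  disp : Option (List ℤ)
  rounds : List (ℤ × ℤ)
  tree : STree C

/-- Nothing chosen yet, the empty tree. -/
def GameState.start (C : Type) : GameState C := ⟨none, [], STree.leaf⟩

/-- The two sequences chosen are equal up to distances with the displacements that are in
use: those chosen by the adversary, and `0`, since every timestamp is inserted undisplaced too. -/
def GameState.Fair {C : Type} (s : GameState C) : Prop :=
  EDD (s.rounds.map Prod.fst) (s.rounds.map Prod.snd)
    (insert 0 {d : ℤ | d ∈ s.disp.getD []})

namespace DetEncScheme

variable (E : DetEncScheme) {κ : ℕ}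

/-- The values to be inserted for the timestamp `v`, namely `v, v + d₁, …, v + dₙ`, as messages,
provided that all of them can be encrypted. -/
def values (κ : ℕ) (D : List ℤ) (v : ℤ) : Option (List (Fin (2 ^ E.msgLen κ))) :=
  (v :: D.map fun d => v + d).mapM (toMsg (E.msgLen κ))

/-- What the adversary sees of a round, as data. -/
def viewVal (o : List (List (Message (E.Ct κ)) × STree (E.Ct κ))) : Val :=
  let ct : E.Ct κ → Val := fun c => Val.int ((c : ℕ) : ℤ)
  Val.ofList (fun p => Val.pair (Val.ofList (Message.toVal ct) p.1) (p.2.toVal ct)) o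

/-- The challenger with key `k` and bit `b`.  The first message of the adversary is the list of
displacements.  Every further message is a pair `(v⁰, v¹)`; the values for `vᵇ` are inserted, and
the adversary gets the messages exchanged and the state of the cloud.  A pair for which some value
cannot be encrypted, on either side, is refused by `nil` and does not count as a round. -/
def challenger (k : E.Key κ) (b : Bool) (s : GameState (E.Ct κ)) (q : Val) :
    Val × GameState (E.Ct κ) :=
  match s.disp with
  | none => (Val.nil, { s with disp := some q.toIntList })
  | some D =>
    match E.values κ D q.fst.toInt, E.values κ D q.snd.toInt with
    | some m₀, some m₁ =>
      let res := E.insertAll k (if b then m₁ else m₀) s.tree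
      (E.viewVal res.2,
        { s with rounds := s.rounds ++ [(q.fst.toInt, q.snd.toInt)], tree := res.1 })
    | _, _ => (Val.nil, s)

open Classical in
/-- The game: whether the adversary wins. -/
noncomputable def game (A : PPT) (κ : ℕ) : PMF Bool :=
  (E.keyGen κ).bind fun k =>
    coin.bind fun b =>
      (A.run κ (E.challenger k b) (GameState.start (E.Ct κ))).map fun out =>
        decide (out.1 = b ∧ out.2.Fair)

/-- The probability that the adversary wins. -/
noncomputable def winProb (A : PPT) (κ : ℕ) : ℝ := (E.game A κ true).toReal

end DetEncScheme

end MOPED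

open MOPED

/-! A ppt distinguisher for the pseudorandom function is built that plays the game with the
adversary.  It tosses the bit `b` itself and takes the role of client and cloud.  It needs no
decryption: since it learns all timestamps in the clear, it can keep each plaintext next to its
ciphertext in the simulated tree and compare plaintexts.  It needs only its oracle, for the
ciphertexts and for the test whether a value lies in the message space.  At the end it checks
equality up to distances for the rounds played, and outputs `1` if and only if the adversary wins.

*With the real oracle* the output has the distribution of the game, because `Dec` inverts `DET`:
the comparisons made by the client are comparisons of plaintexts (`DetEncScheme.challenger_mapTree`,
`DetEncScheme.prReal_distinguisher`).

*With a uniformly random function `f`* the adversary wins with probability at most `1 / 2`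
(`DetEncScheme.uniform_funGame_le`).  Think of the tree as holding the *pairs* of plaintexts, one
for each value of `b`.  As long as the game is fair, the two components of these pairs are ordered
in the same way, so for both bits the same pairs reach the same places of the tree and the same
pairs are found to be present already; and `f` takes independent uniform values at the distinct
plaintexts on either side.  So the fair runs with a given output have the same probability for both
bits.  The proof is an induction over the run in which the values of `f` at the plaintexts inserted
so far are fixed (`DetEncScheme.sumAgree_fairProb`).  That the number of functions with prescribed
values is the same on both sides holds because a partial bijection of a finite set extends to a
permutation (`OrderAgree.exists_perm`).

The difference of the two probabilities is negligible by assumption, which gives the bound.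

*Running time.*  The distinguisher is an explicit program (`Cmd.distinguisher`), in which each
message of the adversary is replaced by the code of the challenger (`Cmd.respond`).  Its effect and
its running time are proved together (`Exec`).  The number of displacements is at most the nesting
depth of the first message, which is linear in the number of steps the adversary has made; the tree
and the list of all pairs of values grow by at most that number plus one per message
(`haltsWithin_compile`). -/

namespace MOPED

/-! ### Search trees over relabelled ciphertexts -/

/-- Relabelling the ciphertexts in a message. -/
def Message.map {C C' : Type} (φ : C → C') : Message C → Message C'
  | .insert c => .insert (φ c)
  | .reveal c => .reveal (φ c)
  | .answer o => .answer o

/-- The ciphertexts in a message satisfy `p`. -/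
def Message.All {C : Type} (p : C → Prop) : Message C → Prop
  | .insert c => p c
  | .reveal c => p c
  | .answer _ => True

namespace STree

variable {C C' : Type}

/-- Relabelling the ciphertexts in a tree. -/
def map (φ : C → C') : STree C → STree C'
  | leaf => leaf
  | node h l c r => node h (l.map φ) (φ c) (r.map φ)

/-- The number of nodes. -/
def size : STree C → ℕ
  | leaf => 0
  | node _ l _ r => l.size + r.size + 1

/-- All ciphertexts in a tree satisfy `p`. -/
def All (p : C → Prop) : STree C → Prop
  | leaf => True
  | node _ l c r => l.All p ∧ p c ∧ r.All p

@[simp] lemma height_map (φ : C → C') (t : STree C) : (t.map φ).height = t.height := by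
  cases t <;> rfl

lemma map_mk (φ : C → C') (l : STree C) (c : C) (r : STree C) :
    (mk l c r).map φ = mk (l.map φ) (φ c) (r.map φ) := by
  simp [mk, map]

lemma map_balance (φ : C → C') (l : STree C) (c : C) (r : STree C) :
    (balance l c r).map φ = balance (l.map φ) (φ c) (r.map φ) := by
  unfold balance
  simp only [height_map]
  split_ifs
  · rcases l with _ | ⟨_, ll, lc, lr⟩
    · exact map_mk ..
    · simp only [map, height_map]
      split_ifs
      · simp only [map_mk]
      · rcases lr with _ | ⟨_, a, x, b⟩ <;> simp only [map_mk, map]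
  · rcases r with _ | ⟨_, rl, rc, rr⟩
    · exact map_mk ..
    · simp only [map, height_map]
      split_ifs
      · simp only [map_mk]
      · rcases rl with _ | ⟨_, a, x, b⟩ <;> simp only [map_mk, map]
  · exact map_mk ..

lemma all_balance {p : C → Prop} {l : STree C} {c : C} {r : STree C}
    (hl : l.All p) (hc : p c) (hr : r.All p) : (balance l c r).All p := by
  unfold balance
  split_ifs
  · rcases l with _ | ⟨_, ll, lc, lr⟩
    · exact ⟨hl, hc, hr⟩
    · obtain ⟨h₁, h₂, h₃⟩ := hl
      dsimp only
      split_ifs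
      · exact ⟨h₁, h₂, h₃, hc, hr⟩
      · rcases lr with _ | ⟨_, a, x, b⟩
        · exact ⟨⟨h₁, h₂, h₃⟩, hc, hr⟩
        · exact ⟨⟨h₁, h₂, h₃.1⟩, h₃.2.1, h₃.2.2, hc, hr⟩
  · rcases r with _ | ⟨_, rl, rc, rr⟩
    · exact ⟨hl, hc, hr⟩
    · obtain ⟨h₁, h₂, h₃⟩ := hr
      dsimp only
      split_ifs
      · exact ⟨⟨hl, hc, h₁⟩, h₂, h₃⟩
      · rcases rl with _ | ⟨_, a, x, b⟩
        · exact ⟨hl, hc, h₁, h₂, h₃⟩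
        · exact ⟨⟨hl, hc, h₁.1⟩, h₁.2.1, h₁.2.2, h₂, h₃⟩
  · exact ⟨hl, hc, hr⟩

lemma size_balance (l : STree C) (c : C) (r : STree C) :
    (balance l c r).size = l.size + r.size + 1 := by
  unfold balance
  split_ifs
  · rcases l with _ | ⟨_, ll, lc, lr⟩
    · rfl
    · dsimp only
      split_ifs
      · simp only [size, mk]; omega
      · rcases lr with _ | ⟨_, a, x, b⟩
        · rfl
        · simp only [size, mk]; omega
  · rcases r with _ | ⟨_, rl, rc, rr⟩
    · rfl
    · dsimp only
      split_ifs
      · simp only [size, mk]; omega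
      · rcases rl with _ | ⟨_, a, x, b⟩
        · rfl
        · simp only [size, mk]; omega
  · rfl

lemma size_walk_le (ans : C → Ordering) (c : C) (t : STree C) :
    (t.walk ans c).1.size ≤ t.size + 1 := by
  induction t with
  | leaf => simp [walk, mk, size]
  | node h l c' r ihl ihr =>
    simp only [walk]
    cases ans c' <;> simp only [size_balance, size] <;> omega

lemma walk_map (φ : C → C') (ans : C → Ordering) (ans' : C' → Ordering)
    (h : ∀ x, ans' (φ x) = ans x) (c : C) (t : STree C) :
    (t.map φ).walk ans' (φ c) =
      ((t.walk ans c).1.map φ, (t.walk ans c).2.map (Message.map φ)) := by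
  induction t with
  | leaf => simp [walk, map, mk, height]
  | node h' l c' r ihl ihr =>
    simp only [walk, map, h, ihl, ihr]
    cases ans c' <;> simp [map_balance, map, Message.map]

lemma all_walk {p : C → Prop} (ans : C → Ordering) {c : C} (hc : p c) {t : STree C}
    (ht : t.All p) :
    (t.walk ans c).1.All p ∧ ∀ m ∈ (t.walk ans c).2, m.All p := by
  induction t with
  | leaf => exact ⟨⟨trivial, hc, trivial⟩, by simp [walk]⟩
  | node h' l c' r ihl ihr =>
    obtain ⟨h₁, h₂, h₃⟩ := ht
    simp only [walk]
    cases ans c'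
    · exact ⟨all_balance (ihl h₁).1 h₂ h₃, by
        simpa [Message.All, h₂] using (ihl h₁).2⟩
    · exact ⟨⟨h₁, h₂, h₃⟩, by simp [Message.All, h₂]⟩
    · exact ⟨all_balance h₁ h₂ (ihr h₃).1, by
        simpa [Message.All, h₂] using (ihr h₃).2⟩

lemma walk_congr {ans ans' : C → Ordering} (c : C) {t : STree C}
    (h : t.All fun x => ans x = ans' x) : t.walk ans c = t.walk ans' c := by
  induction t with
  | leaf => rfl
  | node h' l c' r ihl ihr =>
    obtain ⟨h₁, h₂, h₃⟩ := h
    simp only [walk, h₂, ihl h₁, ihr h₃]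

lemma All.imp {p q : C → Prop} (h : ∀ x, p x → q x) {t : STree C} (ht : t.All p) : t.All q := by
  induction t with
  | leaf => trivial
  | node h' l c' r ihl ihr => exact ⟨ihl ht.1, h _ ht.2.1, ihr ht.2.2⟩

lemma toVal_map (φ : C → C') (ct : C' → Val) (t : STree C) :
    (t.map φ).toVal ct = t.toVal (ct ∘ φ) := by
  induction t with
  | leaf => rfl
  | node h' l c' r ihl ihr => simp [map, toVal, ihl, ihr]

lemma toVal_congr {ct ct' : C → Val} {t : STree C} (h : t.All fun x => ct x = ct' x) :
    t.toVal ct = t.toVal ct' := by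
  induction t with
  | leaf => rfl
  | node h' l c' r ihl ihr => simp [toVal, ihl h.1, ihr h.2.2, h.2.1]

/-- Insertion of several items, one after the other, when items are compared by `cmp`: the final
tree, and for each insertion the messages exchanged and the tree after it. -/
def insertList (cmp : C → C → Ordering) :
    List C → STree C → STree C × List (List (Message C) × STree C)
  | [], t => (t, [])
  | x :: xs, t =>
    let one := t.walk (cmp x) x
    let rest := insertList cmp xs one.1
    (rest.1, (.insert x :: one.2, one.1) :: rest.2)

lemma insertList_append (cmp : C → C → Ordering) (xs ys : List C) (t : STree C) :
    insertList cmp (xs ++ ys) t =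
      ((insertList cmp ys (insertList cmp xs t).1).1,
        (insertList cmp xs t).2 ++ (insertList cmp ys (insertList cmp xs t).1).2) := by
  induction xs generalizing t with
  | nil => rfl
  | cons x xs ih => simp [insertList, ih]

lemma size_insertList_le (cmp : C → C → Ordering) (xs : List C) (t : STree C) :
    (insertList cmp xs t).1.size ≤ t.size + xs.length := by
  induction xs generalizing t with
  | nil => simp [insertList]
  | cons x xs ih =>
    have h₁ := ih (t.walk (cmp x) x).1
    have h₂ := size_walk_le (cmp x) x t
    simp only [insertList, List.length_cons]
    omega

/-- Relabelling in the record of several insertions. -/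
def mapRecord (φ : C → C') (o : List (List (Message C) × STree C)) :
    List (List (Message C') × STree C') :=
  o.map fun p => (p.1.map (Message.map φ), p.2.map φ)

lemma insertList_map (φ : C → C') (cmp : C → C → Ordering) (cmp' : C' → C' → Ordering)
    (h : ∀ x y, cmp' (φ x) (φ y) = cmp x y) (xs : List C) (t : STree C) :
    insertList cmp' (xs.map φ) (t.map φ) =
      ((insertList cmp xs t).1.map φ, mapRecord φ (insertList cmp xs t).2) := by
  induction xs generalizing t with
  | nil => rfl
  | cons x xs ih =>
    simp [insertList, walk_map φ (cmp x) (cmp' (φ x)) (h x), ih, mapRecord, Message.map]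

lemma all_insertList {p : C → Prop} (cmp : C → C → Ordering) {xs : List C} (hxs : ∀ x ∈ xs, p x)
    {t : STree C} (ht : t.All p) :
    (insertList cmp xs t).1.All p ∧
      ∀ o ∈ (insertList cmp xs t).2, (∀ m ∈ o.1, m.All p) ∧ o.2.All p := by
  induction xs generalizing t with
  | nil => exact ⟨ht, by simp [insertList]⟩
  | cons x xs ih =>
    have hx : p x := hxs x (by simp)
    have h₁ := all_walk (cmp x) hx ht
    have h₂ := ih (fun y hy => hxs y (by simp [hy])) h₁.1
    refine ⟨h₂.1, ?_⟩
    simp only [insertList, List.mem_cons, forall_eq_or_imp]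
    exact ⟨⟨⟨hx, h₁.2⟩, h₁.1⟩, h₂.2⟩

lemma insertList_congr {p : C → Prop} {cmp cmp' : C → C → Ordering}
    (h : ∀ x y, p x → p y → cmp x y = cmp' x y) {xs : List C} (hxs : ∀ x ∈ xs, p x)
    {t : STree C} (ht : t.All p) : insertList cmp xs t = insertList cmp' xs t := by
  induction xs generalizing t with
  | nil => rfl
  | cons x xs ih =>
    have hx : p x := hxs x (by simp)
    have h₁ := all_walk (cmp x) hx ht
    have h₂ := walk_congr x (ht.imp fun y hy => h x y hx hy)
    simp only [insertList]
    rw [ih (fun y hy => hxs y (by simp [hy])) h₁.1, h₂]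

end STree

/-- What the adversary sees of several insertions when `x` is shown as `ct x`. -/
def viewOf {C : Type} (ct : C → Val) (o : List (List (Message C) × STree C)) : Val :=
  Val.ofList (fun p => Val.pair (Val.ofList (Message.toVal ct) p.1) (p.2.toVal ct)) o

lemma ofList_map {α β : Type} (f : β → Val) (g : α → β) (l : List α) :
    Val.ofList f (l.map g) = Val.ofList (f ∘ g) l := by
  induction l with
  | nil => rfl
  | cons a l ih => simp [Val.ofList, ih]

lemma ofList_congr {α : Type} {f g : α → Val} {l : List α} (h : ∀ a ∈ l, f a = g a) :
    Val.ofList f l = Val.ofList g l := by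
  induction l with
  | nil => rfl
  | cons a l ih =>
    simp [Val.ofList, h a (by simp), ih fun b hb => h b (by simp [hb])]

lemma viewOf_mapRecord {C C' : Type} (φ : C → C') (ct : C' → Val)
    (o : List (List (Message C) × STree C)) :
    viewOf ct (STree.mapRecord φ o) = viewOf (ct ∘ φ) o := by
  unfold viewOf STree.mapRecord
  rw [ofList_map]
  refine ofList_congr fun p _ => ?_
  simp only [Function.comp_apply, ofList_map, STree.toVal_map]
  congr 1
  refine ofList_congr fun m _ => ?_
  cases m <;> rfl

lemma viewOf_congr {C : Type} {ct ct' : C → Val} {o : List (List (Message C) × STree C)}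
    (h : ∀ x ∈ o, (∀ m ∈ x.1, m.All fun c => ct c = ct' c) ∧ x.2.All fun c => ct c = ct' c) :
    viewOf ct o = viewOf ct' o := by
  refine ofList_congr fun p hp => ?_
  rw [STree.toVal_congr (h p hp).2]
  congr 1
  refine ofList_congr fun m hm => ?_
  have := (h p hp).1 m hm
  cases m <;> simp_all [Message.All, Message.toVal]

/-! ### The game on pairs of plaintexts -/

/-- A message as an integer. -/
def msgInt {n : ℕ} (m : Fin (2 ^ n)) : ℤ := ((m : ℕ) : ℤ)

lemma toMsg_eq_some {n : ℕ} {z : ℤ} {m : Fin (2 ^ n)} : toMsg n z = some m ↔ msgInt m = z := by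
  unfold toMsg msgInt
  split_ifs with h
  · simp only [Option.some.injEq, Fin.ext_iff]
    omega
  · simp only [false_iff]
    intro hz
    apply h
    constructor
    · omega
    · rw [← hz]; simp

lemma toMsg_msgInt {n : ℕ} (m : Fin (2 ^ n)) : toMsg n (msgInt m) = some m :=
  toMsg_eq_some.2 rfl

lemma mapM_toMsg_eq_some {n : ℕ} {zs : List ℤ} {ms : List (Fin (2 ^ n))} :
    zs.mapM (toMsg n) = some ms ↔ ms.map msgInt = zs := by
  induction zs generalizing ms with
  | nil => cases ms <;> simp
  | cons z zs ih =>
    rw [List.mapM_cons]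
    cases ms with
    | nil => simp [Option.bind_eq_some_iff]
    | cons m ms => simp [Option.bind_eq_some_iff, ih, toMsg_eq_some, and_comm]

lemma mapM_toMsg_eq_none {n : ℕ} {zs : List ℤ} :
    zs.mapM (toMsg n) = none ↔ ∃ z ∈ zs, toMsg n z = none := by
  induction zs with
  | nil => simp
  | cons z zs ih =>
    rw [List.mapM_cons]
    simp only [List.mem_cons, exists_eq_or_imp, ← ih]
    cases toMsg n z <;> cases List.mapM (toMsg n) zs <;> simp

/-- The values `v`, `v + d₁`, …, `v + dₙ` for the displacements `D`. -/
def shifts (D : List ℤ) (v : ℤ) : List ℤ := (0 :: D).map fun d => v + d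

/-- The component of a pair that is selected by the challenge bit. -/
def side {α : Type} (b : Bool) (p : α × α) : α := if b then p.2 else p.1

/-- Comparison of pairs on the side selected by the challenge bit. -/
def cmpSide {n : ℕ} (b : Bool) (p q : Fin (2 ^ n) × Fin (2 ^ n)) : Ordering :=
  compare (side b p) (side b q)

lemma map_side_zip {α : Type} (b : Bool) {xs ys : List α} (h : xs.length = ys.length) :
    (xs.zip ys).map (side b) = if b then ys else xs := by
  cases b
  · exact List.map_fst_zip h.le
  · exact List.map_snd_zip h.ge

/-- Relabelling the tree in a state of the game. -/
def GameState.mapTree {C C' : Type} (φ : C → C') (s : GameState C) : GameState C' :=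
  ⟨s.disp, s.rounds, s.tree.map φ⟩

/-- If two parties behave in the same way up to a translation of their states, then so do runs
against them. -/
lemma Config.run_map {σ τ : Type} (φ : τ → σ) (O : σ → Val → Val × σ) (O' : τ → Val → Val × τ)
    (h : ∀ s m, O (φ s) m = ((O' s m).1, φ (O' s m).2)) (n : ℕ) (c : Config) (s : τ) :
    c.run O n (φ s) = (c.run O' n s).map (Prod.map id φ) := by
  induction n generalizing c s with
  | zero => simp [Config.run, PMF.pure_map]
  | succ n ih =>
    simp only [Config.run]
    cases c.next with
    | halt => simp [PMF.pure_map]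
    | tau c' => exact ih c' s
    | toss k => simp only [PMF.map_bind, ih]
    | send m k => simp only [h, ih]

namespace DetEncScheme

variable (E : DetEncScheme) {κ : ℕ}

/-- The plaintexts for security parameter `κ`. -/
abbrev Pt (E : DetEncScheme) (κ : ℕ) : Type := Fin (2 ^ E.msgLen κ)

lemma values_eq (D : List ℤ) (v : ℤ) :
    E.values κ D v = (shifts D v).mapM (toMsg (E.msgLen κ)) := by
  simp [values, shifts]

lemma length_of_values {D : List ℤ} {v : ℤ} {ms : List (E.Pt κ)}
    (h : E.values κ D v = some ms) : ms.length = D.length + 1 := by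
  rw [values_eq, mapM_toMsg_eq_some] at h
  simpa [shifts] using congrArg List.length h

/-- The challenger with bit `b` that keeps, instead of ciphertexts, the pairs of plaintexts of
which it inserts one side, and that shows the plaintext `m` to the adversary as `f m`.  Its state
does not depend on `f`, and (in a fair game) it hardly depends on `b`. -/
def pairChallenger (f : E.Pt κ → Val) (b : Bool) (s : GameState (E.Pt κ × E.Pt κ)) (q : Val) :
    Val × GameState (E.Pt κ × E.Pt κ) :=
  match s.disp with
  | none => (Val.nil, { s with disp := some q.toIntList })
  | some D =>
    match E.values κ D q.fst.toInt, E.values κ D q.snd.toInt with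
    | some m₀, some m₁ =>
      let res := STree.insertList (cmpSide b) (m₀.zip m₁) s.tree
      (viewOf (f ∘ side b) res.2,
        { s with rounds := s.rounds ++ [(q.fst.toInt, q.snd.toInt)], tree := res.1 })
    | _, _ => (Val.nil, s)

lemma insertAll_map_enc (k : E.Key κ) (ms : List (E.Pt κ)) (t : STree (E.Pt κ)) :
    E.insertAll k ms (t.map (E.enc κ k)) =
      ((STree.insertList compare ms t).1.map (E.enc κ k),
        STree.mapRecord (E.enc κ k) (STree.insertList compare ms t).2) := by
  induction ms generalizing t with
  | nil => rfl
  | cons m ms ih =>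
    have h := STree.walk_map (E.enc κ k) (compare m) (fun c' => compare m (E.dec κ k c'))
      (fun x => by rw [E.dec_enc]) m t
    simp [insertAll, insert, h, ih, STree.insertList, STree.mapRecord, Message.map]

/-- The challenger of the game is the challenger on pairs that shows encryptions, because
decryption turns the comparison of ciphertexts into the comparison of plaintexts. -/
lemma challenger_mapTree (k : E.Key κ) (b : Bool) (s : GameState (E.Pt κ × E.Pt κ)) (q : Val) :
    E.challenger k b (s.mapTree (E.enc κ k ∘ side b)) q =
      ((E.pairChallenger (fun m => Val.int (msgInt (E.enc κ k m))) b s q).1,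
        (E.pairChallenger (fun m => Val.int (msgInt (E.enc κ k m))) b s q).2.mapTree
          (E.enc κ k ∘ side b)) := by
  obtain ⟨disp, rounds, tree⟩ := s
  unfold challenger pairChallenger GameState.mapTree
  rcases disp with _ | D
  · rfl
  · dsimp only
    rcases h₀ : E.values κ D q.fst.toInt with _ | m₀ <;>
      rcases h₁ : E.values κ D q.snd.toInt with _ | m₁
    · rfl
    · rfl
    · rfl
    have hlen : m₀.length = m₁.length := by
      rw [E.length_of_values h₀, E.length_of_values h₁]
    have hm : (if b = true then m₁ else m₀) = (m₀.zip m₁).map (side b) :=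
      (map_side_zip b hlen).symm
    have hmap : ∀ t : STree (E.Pt κ × E.Pt κ),
        (t.map (side b)).map (E.enc κ k) = t.map (E.enc κ k ∘ side b) := by
      intro t
      induction t with
      | leaf => rfl
      | node h l c r ihl ihr => simp [STree.map, ihl, ihr]
    dsimp only
    rw [hm, ← hmap tree, insertAll_map_enc,
      STree.insertList_map (side b) (cmpSide b) compare (fun _ _ => rfl)]
    refine Prod.ext ?_ ?_
    · change viewOf (fun c => Val.int (msgInt c)) _ = _
      dsimp only
      rw [viewOf_mapRecord, viewOf_mapRecord]
      rfl
    · simp [hmap]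

open Classical in
/-- The probability that the adversary wins, expressed by the challenger on pairs. -/
lemma game_eq (A : PPT) (κ : ℕ) :
    E.game A κ = (E.keyGen κ).bind fun k => coin.bind fun b =>
      (A.run κ (E.pairChallenger (fun m => Val.int (msgInt (E.enc κ k m))) b)
        (GameState.start _)).map fun out => decide (out.1 = b ∧ out.2.Fair) := by
  unfold game
  congr 1
  funext k
  congr 1
  funext b
  have h := Config.run_map (GameState.mapTree (E.enc κ k ∘ side b)) (E.challenger k b)
    (E.pairChallenger (fun m => Val.int (msgInt (E.enc κ k m))) b)
    (E.challenger_mapTree k b) (A.time.eval κ) (A.prog.start κ) (GameState.start _)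
  unfold PPT.run
  rw [show GameState.start (E.Ct κ) = GameState.mapTree (E.enc κ k ∘ side b) (GameState.start _)
    from rfl, h, PMF.map_comp]
  rfl

end DetEncScheme

/-! ### Security against a uniformly random function -/

/-- The two components of the pairs are ordered in the same way. -/
def OrderAgree {α : Type} [LE α] (L : List (α × α)) : Prop :=
  ∀ x ∈ L, ∀ y ∈ L, (y.1 ≤ x.1 ↔ y.2 ≤ x.2)

/-- All pairs `(v⁰ + d, v¹ + d)` of values that belong to the rounds played. -/
def GameState.pairs {C : Type} (s : GameState C) : List (ℤ × ℤ) :=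
  s.rounds.flatMap fun r => (0 :: s.disp.getD []).map fun d => (r.1 + d, r.2 + d)

lemma GameState.fair_iff {C : Type} (s : GameState C) : s.Fair ↔ OrderAgree s.pairs := by
  unfold GameState.Fair EDD OrderAgree GameState.pairs
  constructor
  · rintro ⟨_, h⟩ x hx y hy
    simp only [List.mem_flatMap, List.mem_map] at hx hy
    obtain ⟨r, hr, d, hd, rfl⟩ := hx
    obtain ⟨r', hr', d', hd', rfl⟩ := hy
    obtain ⟨i, hi, rfl⟩ := List.mem_iff_getElem.1 hr
    obtain ⟨j, hj, rfl⟩ := List.mem_iff_getElem.1 hr'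
    have := h d (by simpa using hd) d' (by simpa using hd')
      ⟨i, by simpa using hi⟩ ⟨j, by simpa using hj⟩
    simpa using this
  · intro h
    refine ⟨by simp, fun d hd d' hd' i j => ?_⟩
    have hi : (i : ℕ) < s.rounds.length := by simpa using i.2
    have hj : (j : ℕ) < s.rounds.length := by simpa using j.2
    have := h ((s.rounds[i]'hi).1 + d, (s.rounds[i]'hi).2 + d)
      (List.mem_flatMap.2 ⟨_, List.getElem_mem hi, List.mem_map.2 ⟨d, by simpa using hd, rfl⟩⟩)
      ((s.rounds[j]'hj).1 + d', (s.rounds[j]'hj).2 + d')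
      (List.mem_flatMap.2 ⟨_, List.getElem_mem hj, List.mem_map.2 ⟨d', by simpa using hd', rfl⟩⟩)
    simpa using this

lemma OrderAgree.mono {α : Type} [LE α] {L L' : List (α × α)} (h : L ⊆ L')
    (h' : OrderAgree L') : OrderAgree L :=
  fun x hx y hy => h' x (h hx) y (h hy)

lemma OrderAgree.eq_iff {α : Type} [LinearOrder α] {L : List (α × α)} (h : OrderAgree L)
    {x y : α × α} (hx : x ∈ L) (hy : y ∈ L) : x.1 = y.1 ↔ x.2 = y.2 := by
  rw [le_antisymm_iff, le_antisymm_iff, h x hx y hy, h y hy x hx]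

lemma OrderAgree.compare_eq {α : Type} [LinearOrder α] {L : List (α × α)} (h : OrderAgree L)
    {x y : α × α} (hx : x ∈ L) (hy : y ∈ L) : compare x.1 y.1 = compare x.2 y.2 := by
  rcases lt_trichotomy x.1 y.1 with h₁ | h₁ | h₁
  · have : x.2 < y.2 := by rwa [← not_le, ← h x hx y hy, not_le]
    rw [compare_lt_iff_lt.2 h₁, compare_lt_iff_lt.2 this]
  · rw [compare_eq_iff_eq.2 h₁, compare_eq_iff_eq.2 ((h.eq_iff hx hy).1 h₁)]
  · have : y.2 < x.2 := by rwa [← not_le, ← h y hy x hx, not_le]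
    rw [compare_gt_iff_gt.2 h₁, compare_gt_iff_gt.2 this]

/-- A partial map between the two components of order-agreeing pairs extends to a permutation. -/
lemma OrderAgree.exists_perm {α : Type} [LinearOrder α] [Fintype α] {L : List (α × α)}
    (h : OrderAgree L) : ∃ σ : Equiv.Perm α, ∀ p ∈ L, σ p.1 = p.2 := by
  classical
  have hex : ∀ a : α, ∃ a' : α, ∀ p ∈ L, p.1 = a → p.2 = a' := by
    intro a
    by_cases ha : ∃ p ∈ L, p.1 = a
    · obtain ⟨p, hp, rfl⟩ := ha
      exact ⟨p.2, fun q hq hqp => (h.eq_iff hq hp).1 hqp⟩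
    · exact ⟨a, fun p hp hpa => (ha ⟨p, hp, hpa⟩).elim⟩
  choose φ hφ using hex
  have hφ' : ∀ p ∈ L, φ p.1 = p.2 := fun p hp => (hφ _ p hp rfl).symm
  obtain ⟨g, hg⟩ := Finset.exists_equiv_extend_of_card_eq (α := α) (β := α)
    (t := Finset.univ) (by simp) (s := (L.map Prod.fst).toFinset) (f := φ) (by simp) (by
      intro a ha a' ha' haa
      simp only [List.coe_toFinset, List.mem_map, Set.mem_ofPred_eq] at ha ha'
      obtain ⟨p, hp, rfl⟩ := ha
      obtain ⟨q, hq, rfl⟩ := ha'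
      rw [hφ' p hp, hφ' q hq] at haa
      exact (h.eq_iff hp hq).2 haa)
  refine ⟨g.trans (Equiv.subtypeUnivEquiv (by simp)), fun p hp => ?_⟩
  have := hg p.1 (by simp only [List.mem_toFinset]; exact List.mem_map_of_mem hp)
  rw [hφ' p hp] at this
  exact this

namespace DetEncScheme

variable (E : DetEncScheme) {κ : ℕ}

/-- The challenger on pairs that encrypts with `f`. -/
def funChallenger (f : E.Pt κ → E.Ct κ) (b : Bool) :
    GameState (E.Pt κ × E.Pt κ) → Val → Val × GameState (E.Pt κ × E.Pt κ) :=
  E.pairChallenger (fun m => Val.int (msgInt (f m))) b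

open Classical in
/-- The probability that a run ends in a fair state with output `x`. -/
noncomputable def fairProb (x : Bool) (f : E.Pt κ → E.Ct κ) (b : Bool) (n : ℕ) (c : Config)
    (s : GameState (E.Pt κ × E.Pt κ)) : ENNReal :=
  ((c.run (E.funChallenger f b) n s).map fun o => decide (o.1 = x ∧ o.2.Fair)) true

open Classical in
lemma fairProb_zero (x : Bool) (f : E.Pt κ → E.Ct κ) (b : Bool) (c : Config)
    (s : GameState (E.Pt κ × E.Pt κ)) :
    E.fairProb x f b 0 c s = PMF.pure (decide ((c.store 0).truth = x ∧ s.Fair)) true := by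
  simp [fairProb, Config.run, PMF.pure_map]

open Classical in
lemma fairProb_halt {c : Config} (hc : c.next = Action.halt) (x : Bool) (f : E.Pt κ → E.Ct κ)
    (b : Bool) (n : ℕ) (s : GameState (E.Pt κ × E.Pt κ)) :
    E.fairProb x f b (n + 1) c s =
      PMF.pure (decide ((c.store 0).truth = x ∧ s.Fair)) true := by
  simp [fairProb, Config.run, hc, PMF.pure_map]

lemma fairProb_tau {c c' : Config} (hc : c.next = Action.tau c') (x : Bool)
    (f : E.Pt κ → E.Ct κ) (b : Bool) (n : ℕ) (s : GameState (E.Pt κ × E.Pt κ)) :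
    E.fairProb x f b (n + 1) c s = E.fairProb x f b n c' s := by
  simp [fairProb, Config.run, hc]

lemma fairProb_toss {c : Config} {k : Bool → Config} (hc : c.next = Action.toss k) (x : Bool)
    (f : E.Pt κ → E.Ct κ) (b : Bool) (n : ℕ) (s : GameState (E.Pt κ × E.Pt κ)) :
    E.fairProb x f b (n + 1) c s = ∑ a, coin a * E.fairProb x f b n (k a) s := by
  simp only [fairProb, Config.run, hc, PMF.map_bind, PMF.bind_apply, tsum_fintype]

lemma fairProb_send {c : Config} {q : Val} {k : Val → Config} (hc : c.next = Action.send q k)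
    (x : Bool) (f : E.Pt κ → E.Ct κ) (b : Bool) (n : ℕ) (s : GameState (E.Pt κ × E.Pt κ)) :
    E.fairProb x f b (n + 1) c s =
      E.fairProb x f b n (k (E.funChallenger f b s q).1) (E.funChallenger f b s q).2 := by
  simp only [fairProb, Config.run, hc]

/-- A pair of timestamps that can be played: the pairs of values to be inserted. -/
lemma zip_map_msgInt {D : List ℤ} {v w : ℤ} {m₀ m₁ : List (E.Pt κ)}
    (h₀ : E.values κ D v = some m₀) (h₁ : E.values κ D w = some m₁) :
    (m₀.zip m₁).map (Prod.map msgInt msgInt) = (0 :: D).map fun d => (v + d, w + d) := by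
  rw [values_eq, mapM_toMsg_eq_some] at h₀ h₁
  rw [← List.zip_map, h₀, h₁, shifts, shifts, List.zip_map']

lemma fair_of_pairChallenger_fair {f : E.Pt κ → Val} {b : Bool}
    {s : GameState (E.Pt κ × E.Pt κ)} {q : Val} (h : (E.pairChallenger f b s q).2.Fair) :
    s.Fair := by
  rw [GameState.fair_iff] at h ⊢
  refine h.mono ?_
  obtain ⟨disp, rounds, tree⟩ := s
  unfold pairChallenger GameState.pairs
  rcases disp with _ | D
  · intro x
    simp only [List.mem_flatMap, Option.getD]
    rintro ⟨r, hr, hx⟩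
    refine ⟨r, hr, ?_⟩
    simp only [List.map_cons, List.map_nil, List.mem_singleton] at hx
    simp [hx]
  · dsimp only
    rcases E.values κ D q.fst.toInt with _ | m₀ <;>
      rcases E.values κ D q.snd.toInt with _ | m₁ <;> intro x hx
    · exact hx
    · exact hx
    · exact hx
    · simp only [List.flatMap_append, List.mem_append]
      exact Or.inl hx

lemma fairProb_eq_zero {x : Bool} {f : E.Pt κ → E.Ct κ} {b : Bool} {n : ℕ} {c : Config}
    {s : GameState (E.Pt κ × E.Pt κ)} (hs : ¬ s.Fair) : E.fairProb x f b n c s = 0 := by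
  induction n generalizing c s with
  | zero => simp [fairProb_zero, hs]
  | succ n ih =>
    cases hc : c.next with
    | halt => simp [E.fairProb_halt hc, hs]
    | tau c' => rw [E.fairProb_tau hc, ih hs]
    | toss k => simp [E.fairProb_toss hc, ih hs]
    | send m k =>
      rw [E.fairProb_send hc]
      exact ih fun h => hs (E.fair_of_pairChallenger_fair h)

/-- `S` lists the pairs of plaintexts inserted so far, in a game that is fair so far. -/
structure Played (S : List (E.Pt κ × E.Pt κ)) (s : GameState (E.Pt κ × E.Pt κ)) : Prop where
  mem_pairs : ∀ x : ℤ × ℤ, x ∈ s.pairs ↔ x ∈ S.map (Prod.map msgInt msgInt)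
  agree : OrderAgree S
  tree : s.tree.All fun p => p ∈ S
  rounds : s.disp = none → s.rounds = []

lemma msgInt_le {n : ℕ} {a b : Fin (2 ^ n)} : msgInt a ≤ msgInt b ↔ a ≤ b :=
  Int.ofNat_le

lemma fair_iff_orderAgree {S : List (E.Pt κ × E.Pt κ)} {s : GameState (E.Pt κ × E.Pt κ)}
    (h : ∀ x : ℤ × ℤ, x ∈ s.pairs ↔ x ∈ S.map (Prod.map msgInt msgInt)) :
    s.Fair ↔ OrderAgree S := by
  rw [GameState.fair_iff]
  constructor
  · intro hs p hp q hq
    simpa [msgInt_le] using hs _ ((h _).2 (List.mem_map_of_mem hp)) _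
      ((h _).2 (List.mem_map_of_mem hq))
  · intro hS x hx y hy
    obtain ⟨p, hp, rfl⟩ := List.mem_map.1 ((h x).1 hx)
    obtain ⟨q, hq, rfl⟩ := List.mem_map.1 ((h y).1 hy)
    simpa [msgInt_le] using hS p hp q hq

open Classical in
/-- The sum of `X f` over the functions `f` whose value at side `b` of `p` is `g p`,
for all pairs `p` in `S`. -/
noncomputable def sumAgree (S : List (E.Pt κ × E.Pt κ)) (g : E.Pt κ × E.Pt κ → E.Ct κ) (b : Bool)
    (X : (E.Pt κ → E.Ct κ) → ENNReal) : ENNReal :=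
  ∑ f : E.Pt κ → E.Ct κ, if ∀ p ∈ S, f (side b p) = g p then X f else 0

lemma sumAgree_congr {S : List (E.Pt κ × E.Pt κ)} {g : E.Pt κ × E.Pt κ → E.Ct κ} {b : Bool}
    {X Y : (E.Pt κ → E.Ct κ) → ENNReal}
    (h : ∀ f, (∀ p ∈ S, f (side b p) = g p) → X f = Y f) :
    E.sumAgree S g b X = E.sumAgree S g b Y := by
  classical
  refine Finset.sum_congr rfl fun f _ => ?_
  split_ifs with hf
  · exact h f hf
  · rfl

/-- The number of functions with prescribed values does not depend on the side. -/
lemma sumAgree_const {S : List (E.Pt κ × E.Pt κ)} (hS : OrderAgree S)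
    (g : E.Pt κ × E.Pt κ → E.Ct κ) (a : ENNReal) :
    E.sumAgree S g false (fun _ => a) = E.sumAgree S g true fun _ => a := by
  classical
  obtain ⟨σ, hσ⟩ := hS.exists_perm
  unfold sumAgree
  refine Fintype.sum_equiv (Equiv.arrowCongr σ (Equiv.refl _)) _ _ fun f => ?_
  refine if_congr (forall₂_congr fun p hp => ?_) rfl rfl
  simp [side, ← hσ p hp]

lemma sumAgree_cons {S : List (E.Pt κ × E.Pt κ)} {p : E.Pt κ × E.Pt κ} (hp : p ∉ S)
    (g : E.Pt κ × E.Pt κ → E.Ct κ) (b : Bool) (X : (E.Pt κ → E.Ct κ) → ENNReal) :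
    E.sumAgree S g b X = ∑ y, E.sumAgree (p :: S) (Function.update g p y) b X := by
  classical
  unfold sumAgree
  rw [Finset.sum_comm]
  refine Finset.sum_congr rfl fun f _ => ?_
  have h : ∀ y, (∀ q ∈ p :: S, f (side b q) = Function.update g p y q) ↔
      f (side b p) = y ∧ ∀ q ∈ S, f (side b q) = g q := by
    intro y
    simp only [List.mem_cons, forall_eq_or_imp, Function.update_self]
    refine and_congr_right fun _ => forall₂_congr fun q hq => ?_
    rw [Function.update_of_ne (by rintro rfl; exact hp hq)]
  simp_rw [h]
  simp [ite_and]

/-- Agreement of the sums for all ways of fixing further values of the function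
implies agreement of the sums themselves. -/
lemma sumAgree_eq_of_append (T S : List (E.Pt κ × E.Pt κ)) (X Y : (E.Pt κ → E.Ct κ) → ENNReal)
    (h : ∀ g, E.sumAgree (T ++ S) g false X = E.sumAgree (T ++ S) g true Y)
    (g : E.Pt κ × E.Pt κ → E.Ct κ) : E.sumAgree S g false X = E.sumAgree S g true Y := by
  induction T generalizing g with
  | nil => exact h g
  | cons p T ih =>
    refine ih (fun g => ?_) g
    by_cases hp : p ∈ T ++ S
    · have hc : ∀ b Z, E.sumAgree (T ++ S) g b Z = E.sumAgree (p :: (T ++ S)) g b Z := by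
        classical
        intro b Z
        refine Finset.sum_congr rfl fun f _ => if_congr ?_ rfl rfl
        simp only [List.mem_cons, forall_eq_or_imp]
        exact ⟨fun hf => ⟨hf p hp, hf⟩, fun hf => hf.2⟩
      rw [hc, hc]
      exact h g
    · rw [E.sumAgree_cons hp, E.sumAgree_cons hp]
      exact Finset.sum_congr rfl fun y _ => h _

/-- The heart of the argument.  As long as the game is fair, both sides insert new plaintexts at the
same moments and at the same places, and a random function has independent uniform values at them.
Hence the final output has the same distribution for both sides, even if the values at the
plaintexts inserted so far are fixed. -/
lemma sumAgree_fairProb (x : Bool) (n : ℕ) (c : Config) (s : GameState (E.Pt κ × E.Pt κ))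
    (S : List (E.Pt κ × E.Pt κ)) (hS : E.Played S s) (g : E.Pt κ × E.Pt κ → E.Ct κ) :
    E.sumAgree S g false (fun f => E.fairProb x f false n c s) =
      E.sumAgree S g true fun f => E.fairProb x f true n c s := by
  classical
  induction n generalizing c s S g with
  | zero =>
    simp only [fairProb_zero]
    exact E.sumAgree_const hS.agree g _
  | succ n ih =>
    cases hn : c.next with
    | halt =>
      simp only [E.fairProb_halt hn]
      exact E.sumAgree_const hS.agree g _
    | tau c' =>
      simp only [E.fairProb_tau hn]
      exact ih c' s S hS g
    | toss k =>
      simp only [E.fairProb_toss hn]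
      have hsum : ∀ (b : Bool) (X : Bool → (E.Pt κ → E.Ct κ) → ENNReal),
          E.sumAgree S g b (fun f => ∑ a, coin a * X a f) =
            ∑ a, coin a * E.sumAgree S g b (X a) := by
        intro b X
        unfold sumAgree
        simp only [Finset.mul_sum]
        rw [Finset.sum_comm]
        refine Finset.sum_congr rfl fun f _ => ?_
        split_ifs <;> simp
      rw [hsum, hsum]
      exact Finset.sum_congr rfl fun a _ => by rw [ih (k a) s S hS g]
    | send q k =>
      simp only [E.fairProb_send hn]
      obtain ⟨disp, rounds, tree⟩ := s
      rcases disp with _ | D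
      · obtain rfl : rounds = [] := hS.rounds rfl
        have hc : ∀ f b, E.funChallenger f b ⟨none, [], tree⟩ q =
            (Val.nil, ⟨some q.toIntList, [], tree⟩) := fun f b => rfl
        simp only [hc]
        have hp := hS.mem_pairs
        have hS' : E.Played S ⟨some q.toIntList, [], tree⟩ :=
          ⟨hp, hS.agree, hS.tree, fun _ => rfl⟩
        exact ih _ _ S hS' g
      rcases h₀ : E.values κ D q.fst.toInt with _ | m₀
      · have hc : ∀ f b, E.funChallenger f b ⟨some D, rounds, tree⟩ q =
            (Val.nil, ⟨some D, rounds, tree⟩) := by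
          intro f b
          simp [funChallenger, pairChallenger, h₀]
        simp only [hc]
        exact ih _ _ S hS g
      rcases h₁ : E.values κ D q.snd.toInt with _ | m₁
      · have hc : ∀ f b, E.funChallenger f b ⟨some D, rounds, tree⟩ q =
            (Val.nil, ⟨some D, rounds, tree⟩) := by
          intro f b
          simp [funChallenger, pairChallenger, h₁]
        simp only [hc]
        exact ih _ _ S hS g
      have hc : ∀ f b, E.funChallenger f b ⟨some D, rounds, tree⟩ q =
          (viewOf ((fun m => Val.int (msgInt (f m))) ∘ side b)
            (STree.insertList (cmpSide b) (m₀.zip m₁) tree).2,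
          ⟨some D, rounds ++ [(q.fst.toInt, q.snd.toInt)],
            (STree.insertList (cmpSide b) (m₀.zip m₁) tree).1⟩) := by
        intro f b
        simp [funChallenger, pairChallenger, h₀, h₁]
      have hpairs : ∀ t x, x ∈ GameState.pairs (C := E.Pt κ × E.Pt κ)
            ⟨some D, rounds ++ [(q.fst.toInt, q.snd.toInt)], t⟩ ↔
          x ∈ (m₀.zip m₁ ++ S).map (Prod.map msgInt msgInt) := by
        intro t x
        rw [List.map_append, E.zip_map_msgInt h₀ h₁, List.mem_append, ← hS.mem_pairs x]
        simp only [GameState.pairs, List.flatMap_append, List.mem_append, Option.getD]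
        rw [or_comm]
        simp
      by_cases hO : OrderAgree (m₀.zip m₁ ++ S)
      · have hcmp : ∀ y z, y ∈ m₀.zip m₁ ++ S → z ∈ m₀.zip m₁ ++ S →
            cmpSide false y z = cmpSide true y z := fun y z hy hz => hO.compare_eq hy hz
        have hz : ∀ y ∈ m₀.zip m₁, y ∈ m₀.zip m₁ ++ S := fun y hy =>
          List.mem_append_left _ hy
        have ht : tree.All fun p => p ∈ m₀.zip m₁ ++ S :=
          hS.tree.imp fun y hy => List.mem_append_right _ hy
        have hins := STree.insertList_congr hcmp hz ht
        have hall := STree.all_insertList (cmpSide true) hz ht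
        -- With the values of `f` at the new plaintexts fixed too, the reply is the same for all `f`
        -- and both sides, so that the induction hypothesis applies to the rest of the run.
        refine E.sumAgree_eq_of_append (m₀.zip m₁) S _ _ (fun g' => ?_) g
        have hview : ∀ (b : Bool) (f : E.Pt κ → E.Ct κ),
            (∀ p ∈ m₀.zip m₁ ++ S, f (side b p) = g' p) →
            E.funChallenger f b ⟨some D, rounds, tree⟩ q =
              (viewOf (fun p => Val.int (msgInt (g' p)))
                (STree.insertList (cmpSide true) (m₀.zip m₁) tree).2,
              ⟨some D, rounds ++ [(q.fst.toInt, q.snd.toInt)],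
                (STree.insertList (cmpSide true) (m₀.zip m₁) tree).1⟩) := by
          intro b f hf
          have hb : STree.insertList (cmpSide b) (m₀.zip m₁) tree =
              STree.insertList (cmpSide true) (m₀.zip m₁) tree := by
            cases b
            · exact hins
            · rfl
          have himp : ∀ p ∈ m₀.zip m₁ ++ S,
              ((fun m => Val.int (msgInt (f m))) ∘ side b) p = Val.int (msgInt (g' p)) :=
            fun p hp => by simp [hf p hp]
          rw [hc, hb]
          refine Prod.ext (viewOf_congr fun o ho => ⟨fun m hm => ?_, ?_⟩) rfl
          · have := (hall.2 o ho).1 m hm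
            cases m with
            | answer o => trivial
            | insert p => exact himp p this
            | reveal p => exact himp p this
          · exact (hall.2 o ho).2.imp himp
        refine (E.sumAgree_congr fun f hf => ?_).trans
          ((ih (k (viewOf (fun p => Val.int (msgInt (g' p)))
                (STree.insertList (cmpSide true) (m₀.zip m₁) tree).2))
              ⟨some D, rounds ++ [(q.fst.toInt, q.snd.toInt)],
                (STree.insertList (cmpSide true) (m₀.zip m₁) tree).1⟩
              (m₀.zip m₁ ++ S) ⟨hpairs _, hO, hall.1, fun h => (Option.some_ne_none D h).elim⟩
                g').trans
            (E.sumAgree_congr fun f hf => ?_).symm)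
        · rw [hview false f hf]
        · rw [hview true f hf]
      · -- The round makes the game unfair for good, and unfair runs do not count.
        have hzero : ∀ b f, fairProb E x f b n (k (E.funChallenger f b ⟨some D, rounds, tree⟩ q).1)
            (E.funChallenger f b ⟨some D, rounds, tree⟩ q).2 = 0 := by
          intro b f
          refine E.fairProb_eq_zero ?_
          rw [hc, E.fair_iff_orderAgree (hpairs _)]
          exact hO
        simp only [hzero]
        simp [sumAgree]

end DetEncScheme

namespace DetEncScheme

variable (E : DetEncScheme) {κ : ℕ}

open Classical in
/-- The game in which plaintexts are encrypted with `f`. -/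
noncomputable def funGame (A : PPT) (f : E.Pt κ → E.Ct κ) : PMF Bool :=
  coin.bind fun b => (A.run κ (E.funChallenger f b) (GameState.start _)).map fun out =>
    decide (out.1 = b ∧ out.2.Fair)

lemma coin_apply (b : Bool) : coin b = 2⁻¹ := by
  simp [coin]

lemma fairProb_add_le_one (f : E.Pt κ → E.Ct κ) (b : Bool) (n : ℕ) (c : Config)
    (s : GameState (E.Pt κ × E.Pt κ)) :
    E.fairProb false f b n c s + E.fairProb true f b n c s ≤ 1 := by
  classical
  set p := c.run (E.funChallenger f b) n s
  have h : ∀ x, E.fairProb x f b n c s ≤ (p.map Prod.fst) x := by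
    intro x
    unfold fairProb
    rw [PMF.map_apply, PMF.map_apply]
    refine ENNReal.tsum_le_tsum fun o => ?_
    by_cases ho : o.1 = x <;> by_cases hf : o.2.Fair <;> simp [ho, hf, eq_comm, p]
  calc _ ≤ (p.map Prod.fst) false + (p.map Prod.fst) true := add_le_add (h _) (h _)
    _ = 1 := by
      have := (p.map Prod.fst).tsum_coe
      rw [tsum_fintype, Fintype.sum_bool, add_comm] at this
      exact this

/-- Against a uniformly random function, the adversary does not win with a probability greater than
one half: the fair runs with output `0` have the same probability for both bits. -/
lemma uniform_funGame_le (A : PPT) (κ : ℕ) :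
    ((PMF.uniformOfFintype (E.Pt κ → E.Ct κ)).bind fun f => E.funGame A f) true ≤ 2⁻¹ := by
  classical
  have hgame : ∀ f : E.Pt κ → E.Ct κ, E.funGame A f true =
      2⁻¹ * (E.fairProb true f true (A.time.eval κ) (A.prog.start κ) (GameState.start _) +
        E.fairProb false f false (A.time.eval κ) (A.prog.start κ) (GameState.start _)) := by
    intro f
    simp only [funGame, PMF.bind_apply, tsum_fintype, Fintype.sum_bool, coin_apply, mul_add]
    rfl
  have hsum := E.sumAgree_fairProb false (A.time.eval κ) (A.prog.start κ)
    (GameState.start (E.Pt κ × E.Pt κ)) []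
    ⟨by simp [GameState.pairs, GameState.start], by simp [OrderAgree], trivial, fun _ => rfl⟩
    (fun _ => 0)
  simp only [sumAgree, List.not_mem_nil, false_imp_iff, implies_true, if_true] at hsum
  rw [PMF.bind_apply, tsum_fintype]
  simp only [PMF.uniformOfFintype_apply, hgame]
  rw [← Finset.mul_sum, ← Finset.mul_sum, Finset.sum_add_distrib, hsum,
    ← Finset.sum_add_distrib]
  have hle : ∑ f : E.Pt κ → E.Ct κ,
      (E.fairProb true f true (A.time.eval κ) (A.prog.start κ) (GameState.start _) +
        E.fairProb false f true (A.time.eval κ) (A.prog.start κ) (GameState.start _)) ≤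
      (Fintype.card (E.Pt κ → E.Ct κ) : ENNReal) := by
    refine (Finset.sum_le_card_nsmul _ _ 1 fun f _ => ?_).trans (by simp)
    rw [add_comm]
    exact E.fairProb_add_le_one f true _ _ _
  calc _ ≤ (Fintype.card (E.Pt κ → E.Ct κ) : ENNReal)⁻¹ *
        (2⁻¹ * (Fintype.card (E.Pt κ → E.Ct κ) : ENNReal)) := by gcongr
    _ = 2⁻¹ := by
      rw [mul_comm, mul_assoc, ENNReal.mul_inv_cancel, mul_one]
      · exact Nat.cast_ne_zero.2 Fintype.card_ne_zero
      · exact ENNReal.natCast_ne_top _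

end DetEncScheme

/-! ### A program logic with running times -/

/-- From `c`, at most `n` steps without coin tosses lead to a configuration that satisfies `Q`,
provided that every query `m` is answered by some `r` with `ρ m r`. -/
def Steps (ρ : Val → Val → Prop) : ℕ → Config → (Config → Prop) → Prop
  | 0, c, Q => Q c
  | n + 1, c, Q => Q c ∨ match c.next with
    | Action.halt => False
    | Action.tau c' => Steps ρ n c' Q
    | Action.toss _ => False
    | Action.send m k => ∀ r, ρ m r → Steps ρ n (k r) Q

/-- Executed from `s`, the command `c` takes at most `n` steps, tosses no coins, and ends with
registers that satisfy `P`, provided that its queries are answered as `ρ` allows. -/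
def Exec (ρ : Val → Val → Prop) (c : Cmd) (s : Store) (n : ℕ) (P : Store → Prop) : Prop :=
  ∀ (k : List Cmd) (m : ℕ) (Q : Config → Prop), (∀ s', P s' → Steps ρ m ⟨k, s'⟩ Q) →
    Steps ρ (n + m) ⟨c :: k, s⟩ Q

variable {ρ : Val → Val → Prop}

lemma Steps.of_pred {n : ℕ} {c : Config} {Q : Config → Prop} (h : Q c) : Steps ρ n c Q := by
  cases n
  · exact h
  · exact Or.inl h

lemma Steps.mono {n n' : ℕ} (hn : n ≤ n') {c : Config} {Q : Config → Prop}
    (h : Steps ρ n c Q) : Steps ρ n' c Q := by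
  induction n generalizing n' c with
  | zero => exact .of_pred h
  | succ n ih =>
    obtain ⟨n', rfl⟩ : ∃ i, n' = i + 1 := ⟨n' - 1, by omega⟩
    refine h.imp id fun h => ?_
    cases hc : c.next with
    | halt => simp [hc] at h
    | toss k => simp [hc] at h
    | tau c' => simp only [hc] at h ⊢; exact ih (by omega) h
    | send m k => simp only [hc] at h ⊢; exact fun r hr => ih (by omega) (h r hr)

namespace Exec

lemma mono {c : Cmd} {s : Store} {n n' : ℕ} {P P' : Store → Prop} (h : Exec ρ c s n P)
    (hn : n ≤ n') (hP : ∀ s', P s' → P' s') : Exec ρ c s n' P' :=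
  fun k m Q hQ => (h k m Q fun s' hs' => hQ s' (hP s' hs')).mono (by omega)

lemma seq {c₁ c₂ : Cmd} {s : Store} {n₁ n₂ : ℕ} {P P' : Store → Prop}
    (h₁ : Exec ρ c₁ s n₁ P') (h₂ : ∀ s', P' s' → Exec ρ c₂ s' n₂ P) :
    Exec ρ (.seq c₁ c₂) s (n₁ + n₂ + 1) P := by
  intro k m Q hQ
  have := h₁ (c₂ :: k) (n₂ + m) Q fun s' hs' => h₂ s' hs' k m Q hQ
  rw [show n₁ + n₂ + 1 + m = (n₁ + (n₂ + m)) + 1 by ring]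
  exact Or.inr this

lemma ite {e : Expr} {c₁ c₂ : Cmd} {s : Store} {n : ℕ} {P : Store → Prop}
    (h₁ : (e.eval s).truth = true → Exec ρ c₁ s n P)
    (h₂ : (e.eval s).truth = false → Exec ρ c₂ s n P) : Exec ρ (.ite e c₁ c₂) s (n + 1) P := by
  intro k m Q hQ
  rw [show n + 1 + m = (n + m) + 1 by ring]
  refine Or.inr ?_
  simp only [Config.next]
  cases h : (e.eval s).truth
  · exact h₂ h k m Q hQ
  · exact h₁ h k m Q hQ

lemma send {x : ℕ} {e : Expr} {s : Store} {P : Store → Prop}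
    (h : ∀ r, ρ (e.eval s) r → P (Function.update s x r)) : Exec ρ (.send x e) s 1 P := by
  intro k m Q hQ
  rw [add_comm]
  exact Or.inr fun r hr => hQ _ (h r hr)

/-- A loop with the invariant `I j`, where `j` decreases in each iteration. -/
lemma loop {e : Expr} {c : Cmd} {n : ℕ} {P : Store → Prop} (I : ℕ → Store → Prop)
    (h : ∀ j s, I j s → ((e.eval s).truth = false ∧ P s) ∨
      ((e.eval s).truth = true ∧ ∃ i < j, Exec ρ c s n (I i))) (j : ℕ) (s : Store) (hI : I j s) :
    Exec ρ (.loop e c) s (j * (n + 1) + 1) P := by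
  induction j using Nat.strong_induction_on generalizing s with
  | _ j ih =>
    intro k m Q hQ
    rw [show j * (n + 1) + 1 + m = (j * (n + 1) + m) + 1 by ring]
    refine Or.inr ?_
    simp only [Config.next]
    rcases h j s hI with ⟨ht, hP⟩ | ⟨ht, i, hij, hc⟩
    · simp only [ht]
      exact (hQ s hP).mono (by omega)
    · simp only [ht, if_true]
      refine (hc (.loop e c :: k) (i * (n + 1) + 1 + m) Q fun s' hs' =>
        ih i hij s' hs' k m Q hQ).mono ?_
      have : (i + 1) * (n + 1) ≤ j * (n + 1) := Nat.mul_le_mul_right _ hij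
      rw [add_mul] at this
      omega

end Exec

namespace Cmd

/-- The commands of a list, one after the other. -/
def block : List Cmd → Cmd
  | [] => .skip
  | [c] => c
  | c :: cs => .seq c (block cs)

/-- Commands without loops, tosses and messages. -/
def simple : Cmd → Bool
  | skip => true
  | assign _ _ => true
  | seq c₁ c₂ => c₁.simple && c₂.simple
  | ite _ c₁ c₂ => c₁.simple && c₂.simple
  | _ => false

/-- The effect of a simple command on the registers. -/
def effect : Cmd → Store → Store
  | assign x e, s => Function.update s x (e.eval s)
  | seq c₁ c₂, s => c₂.effect (c₁.effect s)
  | ite e c₁ c₂, s => bif (e.eval s).truth then c₁.effect s else c₂.effect s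
  | _, s => s

/-- A bound for the running time of a simple command. -/
def cost : Cmd → ℕ
  | seq c₁ c₂ => c₁.cost + c₂.cost + 1
  | ite _ c₁ c₂ => max c₁.cost c₂.cost + 1
  | _ => 1

end Cmd

lemma Exec.of_simple {c : Cmd} (hc : c.simple = true) (s : Store) :
    Exec ρ c s c.cost fun s' => s' = c.effect s := by
  induction c generalizing s with
  | skip =>
    intro k m Q hQ
    rw [show Cmd.cost _ = 1 from rfl, add_comm]
    exact Or.inr (hQ s rfl)
  | assign x e =>
    intro k m Q hQ
    rw [show Cmd.cost _ = 1 from rfl, add_comm]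
    exact Or.inr (hQ _ rfl)
  | seq c₁ c₂ ih₁ ih₂ =>
    simp only [Cmd.simple, Bool.and_eq_true] at hc
    refine (ih₁ hc.1 s).seq ?_
    rintro s' rfl
    exact ih₂ hc.2 _
  | ite e c₁ c₂ ih₁ ih₂ =>
    simp only [Cmd.simple, Bool.and_eq_true] at hc
    refine Exec.ite (fun h => ?_) fun h => ?_
    · exact (ih₁ hc.1 s).mono (le_max_left _ _) fun s' hs' => by simp [Cmd.effect, h, hs']
    · exact (ih₂ hc.2 s).mono (le_max_right _ _) fun s' hs' => by simp [Cmd.effect, h, hs']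
  | loop e c => simp [Cmd.simple] at hc
  | toss x => simp [Cmd.simple] at hc
  | send x e => simp [Cmd.simple] at hc

lemma Exec.simple {c : Cmd} (hc : c.simple = true) {s : Store} {n : ℕ} {P : Store → Prop}
    (hn : c.cost ≤ n) (h : P (c.effect s)) : Exec ρ c s n P :=
  (Exec.of_simple hc s).mono hn fun _ hs' => hs' ▸ h

lemma Config.HaltsWithin.mono {n n' : ℕ} (hn : n ≤ n') {c : Config} (h : c.HaltsWithin n) :
    c.HaltsWithin n' := by
  induction n generalizing n' c with
  | zero =>
    have h : c.next = Action.halt := h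
    cases n'
    · exact h
    · simp [Config.HaltsWithin, h]
  | succ n ih =>
    obtain ⟨n', rfl⟩ : ∃ i, n' = i + 1 := ⟨n' - 1, by omega⟩
    unfold Config.HaltsWithin at h ⊢
    cases hc : c.next with
    | halt => trivial
    | toss k => simp only [hc] at h ⊢; exact fun b => ih (by omega) (h b)
    | tau c' => simp only [hc] at h ⊢; exact ih (by omega) h
    | send m k => simp only [hc] at h ⊢; exact fun r => ih (by omega) (h r)

lemma Steps.haltsWithin {n m : ℕ} {c : Config}
    (h : Steps (fun _ _ => True) n c (Config.HaltsWithin m)) : c.HaltsWithin (n + m) := by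
  induction n generalizing c with
  | zero => exact (zero_add m).symm ▸ h
  | succ n ih =>
    rcases h with h | h
    · exact h.mono (by omega)
    rw [show n + 1 + m = (n + m) + 1 by ring]
    unfold Config.HaltsWithin
    cases hc : c.next with
    | halt => trivial
    | toss k => simp [hc] at h
    | tau c' => simp only [hc] at h ⊢; exact ih h
    | send q k => simp only [hc] at h ⊢; exact fun r => ih (h r trivial)

lemma Config.HaltsWithin.run_eq {σ : Type} (O : σ → Val → Val × σ) {n : ℕ} {c : Config}
    (h : c.HaltsWithin n) {m : ℕ} (hm : n ≤ m) (s : σ) : c.run O m s = c.run O n s := by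
  induction n generalizing c m s with
  | zero =>
    have h : c.next = Action.halt := h
    cases m
    · rfl
    · simp [Config.run, h]
  | succ n ih =>
    obtain ⟨m, rfl⟩ : ∃ i, m = i + 1 := ⟨m - 1, by omega⟩
    unfold Config.HaltsWithin at h
    unfold Config.run
    cases hc : c.next with
    | halt => rfl
    | toss k =>
      simp only [hc] at h ⊢
      exact congrArg _ (funext fun b => ih (h b) (by omega) s)
    | tau c' => simp only [hc] at h ⊢; exact ih h (by omega) s
    | send q k => simp only [hc] at h ⊢; exact ih (h _) (by omega) _

/-- With the oracle `O`, long enough runs from `c` have the output distribution `μ`. -/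
def Outputs (O : Unit → Val → Val × Unit) (c : Config) (μ : PMF Bool) : Prop :=
  ∃ n, ∀ m, n ≤ m → (c.run O m ()).map Prod.fst = μ

namespace Outputs

variable {O : Unit → Val → Val × Unit}

lemma halt {c : Config} (hc : c.next = Action.halt) :
    Outputs O c (PMF.pure (c.store 0).truth) := by
  refine ⟨0, fun m _ => ?_⟩
  cases m <;> simp [Config.run, hc, PMF.pure_map]

lemma tau {c c' : Config} (hc : c.next = Action.tau c') {μ : PMF Bool} (h : Outputs O c' μ) :
    Outputs O c μ := by
  obtain ⟨n, h⟩ := h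
  refine ⟨n + 1, fun m hm => ?_⟩
  obtain ⟨m, rfl⟩ : ∃ i, m = i + 1 := ⟨m - 1, by omega⟩
  simpa [Config.run, hc] using h m (by omega)

lemma toss {c : Config} {k : Bool → Config} (hc : c.next = Action.toss k) {μ : Bool → PMF Bool}
    (h : ∀ b, Outputs O (k b) (μ b)) : Outputs O c (coin.bind μ) := by
  choose n h using h
  refine ⟨max (n true) (n false) + 1, fun m hm => ?_⟩
  obtain ⟨m, rfl⟩ : ∃ i, m = i + 1 := ⟨m - 1, by omega⟩
  simp only [Config.run, hc, PMF.map_bind]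
  refine congrArg _ (funext fun b => h b m ?_)
  cases b <;> omega

lemma of_steps {n : ℕ} {c : Config} {μ : PMF Bool}
    (h : Steps (fun q r => r = (O () q).1) n c fun c' => Outputs O c' μ) : Outputs O c μ := by
  induction n generalizing c with
  | zero => exact h
  | succ n ih =>
    rcases h with h | h
    · exact h
    cases hc : c.next with
    | halt => simp [hc] at h
    | toss k => simp [hc] at h
    | tau c' => simp only [hc] at h; exact (ih h).tau hc
    | send q k =>
      simp only [hc] at h
      obtain ⟨i, h⟩ := ih (h _ rfl)
      refine ⟨i + 1, fun m hm => ?_⟩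
      obtain ⟨m, rfl⟩ : ∃ i, m = i + 1 := ⟨m - 1, by omega⟩
      simpa [Config.run, hc] using h m (by omega)

lemma run_eq {n : ℕ} {c : Config} {μ : PMF Bool} (h : Outputs O c μ) (hc : c.HaltsWithin n) :
    (c.run O n ()).map Prod.fst = μ := by
  obtain ⟨i, h⟩ := h
  rw [← hc.run_eq O (le_max_left n i), h _ (le_max_right n i)]

end Outputs

/-! ### Insertion into a search tree as a program -/

/-- A tree over pairs (plaintext, ciphertext) as data.  Each node carries its plaintext, the display
form of its subtree in which only the ciphertexts appear, and its two subtrees. -/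
def augVal : STree (ℤ × Val) → Val
  | .leaf => .nil
  | .node h l x r => .pair (.int x.1)
      (.pair ((STree.node h l x r).toVal Prod.snd) (.pair (augVal l) (augVal r)))

namespace Expr

/-- The plaintext at the root of a tree. -/
def rootPt (e : Expr) : Expr := fst e
/-- The display form of a tree. -/
def display (e : Expr) : Expr := fst (snd e)
/-- The ciphertext at the root of a tree. -/
def rootCt (e : Expr) : Expr := fst (snd (display e))
/-- The left subtree. -/
def left (e : Expr) : Expr := fst (snd (snd e))
/-- The right subtree. -/
def right (e : Expr) : Expr := snd (snd (snd e))
/-- The height of a tree. -/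
def height (e : Expr) : Expr := fst (display e)
/-- A tree with the height `h`, the plaintext `m` and the ciphertext `c`. -/
def node (h m c l r : Expr) : Expr :=
  pair m (pair (pair h (pair c (pair (display l) (display r)))) (pair l r))

variable {s : Store} {e : Expr} {t : STree (ℤ × Val)}

lemma eval_display (h : e.eval s = augVal t) : (display e).eval s = t.toVal Prod.snd := by
  cases t <;> simp [display, eval, h, augVal, Val.fst, Val.snd, STree.toVal]

lemma toInt_height (h : e.eval s = augVal t) : ((height e).eval s).toInt = t.height := by
  rw [height, eval, eval_display h]
  cases t <;> simp [STree.toVal, Val.fst, Val.toInt, STree.height]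

variable {h : ℕ} {l r : STree (ℤ × Val)} {x : ℤ × Val}

lemma eval_rootPt (he : e.eval s = augVal (.node h l x r)) : (rootPt e).eval s = .int x.1 := by
  simp [rootPt, eval, he, augVal, Val.fst]

lemma eval_rootCt (he : e.eval s = augVal (.node h l x r)) : (rootCt e).eval s = x.2 := by
  simp [rootCt, eval, eval_display he, STree.toVal, Val.fst, Val.snd]

lemma eval_left (he : e.eval s = augVal (.node h l x r)) : (left e).eval s = augVal l := by
  simp [left, eval, he, augVal, Val.fst, Val.snd]

lemma eval_right (he : e.eval s = augVal (.node h l x r)) : (right e).eval s = augVal r := by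
  simp [right, eval, he, augVal, Val.snd]

end Expr

@[simp] lemma truth_ofBool (b : Bool) : (Val.ofBool b).truth = b := by cases b <;> rfl

@[simp] lemma truth_nil : Val.nil.truth = false := rfl

@[simp] lemma truth_int (z : ℤ) : (Val.int z).truth = true := rfl

@[simp] lemma toInt_int (z : ℤ) : (Val.int z).toInt = z := rfl

namespace Cmd

open MOPED.Expr in
/-- Puts a node with the right height into the register `d`. -/
def mkNode (d : ℕ) (l m c r : Expr) : Cmd :=
  ite (le (height l) (height r))
    (assign d (node (add (height r) (lit 1)) m c l r))
    (assign d (node (add (height l) (lit 1)) m c l r))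

lemma effect_mkNode {d : ℕ} {l m c r : Expr} {s : Store} {tl tr : STree (ℤ × Val)} {x : ℤ × Val}
    (hl : l.eval s = augVal tl) (hm : m.eval s = .int x.1) (hc : c.eval s = x.2)
    (hr : r.eval s = augVal tr) :
    (mkNode d l m c r).effect s = Function.update s d (augVal (.mk tl x tr)) := by
  simp only [mkNode, effect, Expr.eval, Expr.toInt_height hl, Expr.toInt_height hr, truth_ofBool,
    Expr.node, Expr.eval_display hl, Expr.eval_display hr, hm, hc, hl, hr, Bool.cond_decide,
    toInt_int, STree.mk, augVal, STree.toVal, Nat.cast_le]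
  split_ifs with h
  · rw [max_eq_right h]; rfl
  · rw [max_eq_left (le_of_not_ge h)]; rfl

open MOPED.Expr in
/-- Balances the node with the left subtree, plaintext, ciphertext and right subtree in the
registers 3, 4, 5 and 6, and puts the result into register 2. -/
def balanceNode : Cmd :=
  ite (le (add (height (var 6)) (lit 2)) (height (var 3)))
    (ite (le (height (right (var 3))) (height (left (var 3))))
      (block [mkNode 0 (right (var 3)) (var 4) (var 5) (var 6),
        mkNode 2 (left (var 3)) (rootPt (var 3)) (rootCt (var 3)) (var 0)])
      (block [
        mkNode 0 (left (var 3)) (rootPt (var 3)) (rootCt (var 3)) (left (right (var 3))),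
        mkNode 1 (right (right (var 3))) (var 4) (var 5) (var 6),
        mkNode 2 (var 0) (rootPt (right (var 3))) (rootCt (right (var 3))) (var 1)]))
    (ite (le (add (height (var 3)) (lit 2)) (height (var 6)))
      (ite (le (height (left (var 6))) (height (right (var 6))))
        (block [mkNode 0 (var 3) (var 4) (var 5) (left (var 6)),
          mkNode 2 (var 0) (rootPt (var 6)) (rootCt (var 6)) (right (var 6))])
        (block [
          mkNode 0 (var 3) (var 4) (var 5) (left (left (var 6))),
          mkNode 1 (right (left (var 6))) (rootPt (var 6)) (rootCt (var 6)) (right (var 6)),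
          mkNode 2 (var 0) (rootPt (left (var 6))) (rootCt (left (var 6))) (var 1)]))
      (mkNode 2 (var 3) (var 4) (var 5) (var 6)))

lemma effect_balanceNode {s : Store} {l r : STree (ℤ × Val)} {x : ℤ × Val}
    (hl : s 3 = augVal l) (hm : s 4 = .int x.1) (hc : s 5 = x.2) (hr : s 6 = augVal r) :
    balanceNode.effect s 2 = augVal (.balance l x r) ∧
      ∀ i, 3 ≤ i → balanceNode.effect s i = s i := by
  have hlr : (((l.height : ℕ) : ℤ) + 2 ≤ r.height) ↔ l.height + 1 < r.height := by omega
  have hrl : (((r.height : ℕ) : ℤ) + 2 ≤ l.height) ↔ r.height + 1 < l.height := by omega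
  have hfr : ∀ {i j : ℕ} {v : Val} (s : Store), i < 3 → 3 ≤ j → Function.update s i v j = s j :=
    fun s hi hj => Function.update_of_ne (by omega) _ _
  have hl' : (Expr.var 3).eval s = augVal l := hl
  have hm' : (Expr.var 4).eval s = .int x.1 := hm
  have hc' : (Expr.var 5).eval s = x.2 := hc
  have hr' : (Expr.var 6).eval s = augVal r := hr
  have hl₁ : ∀ v, (Expr.var 3).eval (Function.update s 0 v) = augVal l := fun v =>
    (hfr s (by omega) (by omega)).trans hl
  have hr₁ : ∀ v, (Expr.var 6).eval (Function.update s 0 v) = augVal r := fun v =>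
    (hfr s (by omega) (by omega)).trans hr
  have hm₁ : ∀ v, (Expr.var 4).eval (Function.update s 0 v) = .int x.1 := fun v =>
    (hfr s (by omega) (by omega)).trans hm
  have hc₁ : ∀ v, (Expr.var 5).eval (Function.update s 0 v) = x.2 := fun v =>
    (hfr s (by omega) (by omega)).trans hc
  have hl₂ : ∀ v w, (Expr.var 3).eval (Function.update (Function.update s 0 v) 1 w) = augVal l :=
    fun v w => (hfr _ (by omega) (by omega)).trans (hl₁ v)
  have hr₂ : ∀ v w, (Expr.var 6).eval (Function.update (Function.update s 0 v) 1 w) = augVal r :=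
    fun v w => (hfr _ (by omega) (by omega)).trans (hr₁ v)
  have h₀ : ∀ {t : STree (ℤ × Val)},
      (Expr.var 0).eval (Function.update s 0 (augVal t)) = augVal t := Function.update_self ..
  have h₀₁ : ∀ {t : STree (ℤ × Val)} {w : Val},
      (Expr.var 0).eval (Function.update (Function.update s 0 (augVal t)) 1 w) = augVal t := by
    intro t w
    simp [Expr.eval]
  have h₁ : ∀ {t : STree (ℤ × Val)} {v : Val},
      (Expr.var 1).eval (Function.update (Function.update s 0 v) 1 (augVal t)) = augVal t := by
    intro t v
    simp [Expr.eval]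
  have hfr₂ : ∀ {v w : Val} {i : ℕ}, 3 ≤ i →
      Function.update (Function.update s 0 v) 2 w i = s i := fun hi => by
    rw [hfr _ (by omega) hi, hfr _ (by omega) hi]
  have hfr₃ : ∀ {v u w : Val} {i : ℕ}, 3 ≤ i →
      Function.update (Function.update (Function.update s 0 v) 1 u) 2 w i = s i := fun hi => by
    rw [hfr _ (by omega) hi, hfr _ (by omega) hi, hfr _ (by omega) hi]
  simp only [balanceNode]
  rw [effect]
  simp only [Expr.eval, Expr.toInt_height hl', Expr.toInt_height hr', truth_ofBool,
    Bool.cond_decide, toInt_int, hrl, STree.balance]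
  by_cases h : r.height + 1 < l.height
  · simp only [h, if_true]
    rcases l with _ | ⟨_, ll, lx, lr⟩
    · simp [STree.height] at h
    rw [effect]
    simp only [Expr.eval, Expr.toInt_height (Expr.eval_right hl'),
      Expr.toInt_height (Expr.eval_left hl'), truth_ofBool, Bool.cond_decide, Nat.cast_le]
    split_ifs with h'
    · simp only [block]
      rw [effect, effect_mkNode (Expr.eval_right hl') hm' hc' hr',
        effect_mkNode (Expr.eval_left (hl₁ _)) (Expr.eval_rootPt (hl₁ _))
          (Expr.eval_rootCt (hl₁ _)) h₀]
      exact ⟨Function.update_self .., fun i hi => hfr₂ hi⟩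
    · rcases lr with _ | ⟨_, a, y, b⟩
      · simp [STree.height] at h'
      simp only [block]
      rw [effect, effect, effect_mkNode (Expr.eval_left hl') (Expr.eval_rootPt hl')
          (Expr.eval_rootCt hl') (Expr.eval_left (Expr.eval_right hl')),
        effect_mkNode (Expr.eval_right (Expr.eval_right (hl₁ _))) (hm₁ _) (hc₁ _) (hr₁ _),
        effect_mkNode h₀₁ (Expr.eval_rootPt (Expr.eval_right (hl₂ _ _)))
          (Expr.eval_rootCt (Expr.eval_right (hl₂ _ _))) h₁]
      exact ⟨Function.update_self .., fun i hi => hfr₃ hi⟩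
  · simp only [h, if_false]
    rw [effect]
    simp only [Expr.eval, Expr.toInt_height hl', Expr.toInt_height hr', truth_ofBool,
      Bool.cond_decide, toInt_int, hlr]
    by_cases h' : l.height + 1 < r.height
    · simp only [h', if_true]
      rcases r with _ | ⟨_, rl, rx, rr⟩
      · simp [STree.height] at h'
      rw [effect]
      simp only [Expr.eval, Expr.toInt_height (Expr.eval_right hr'),
        Expr.toInt_height (Expr.eval_left hr'), truth_ofBool, Bool.cond_decide, Nat.cast_le]
      split_ifs with h''
      · simp only [block]
        rw [effect, effect_mkNode hl' hm' hc' (Expr.eval_left hr'),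
          effect_mkNode h₀ (Expr.eval_rootPt (hr₁ _))
            (Expr.eval_rootCt (hr₁ _)) (Expr.eval_right (hr₁ _))]
        exact ⟨Function.update_self .., fun i hi => hfr₂ hi⟩
      · rcases rl with _ | ⟨_, a, y, b⟩
        · simp [STree.height] at h''
        simp only [block]
        rw [effect, effect, effect_mkNode hl' hm' hc' (Expr.eval_left (Expr.eval_left hr')),
          effect_mkNode (Expr.eval_right (Expr.eval_left (hr₁ _))) (Expr.eval_rootPt (hr₁ _))
            (Expr.eval_rootCt (hr₁ _)) (Expr.eval_right (hr₁ _)),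
          effect_mkNode h₀₁ (Expr.eval_rootPt (Expr.eval_left (hr₂ _ _)))
            (Expr.eval_rootCt (Expr.eval_left (hr₂ _ _))) h₁]
        exact ⟨Function.update_self .., fun i hi => hfr₃ hi⟩
    · simp only [h', if_false]
      rw [effect_mkNode hl' hm' hc' hr']
      exact ⟨Function.update_self .., fun i hi => hfr s (by omega) hi⟩

end Cmd

/-- Comparison of the plaintexts. -/
def cmpPt (x y : ℤ × Val) : Ordering := compare x.1 y.1

/-- An ancestor of the current node: its direction (whether the walk went right) and its data. -/
structure Frame : Type where
  right : Bool
  h : ℕ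
  l : STree (ℤ × Val)
  x : ℤ × Val
  r : STree (ℤ × Val)

namespace Frame

/-- An ancestor as data. -/
def toVal (F : Frame) : Val := .pair (Val.ofBool F.right) (augVal (.node F.h F.l F.x F.r))

/-- The result of a walk from an ancestor, given the result of the walk from its child. -/
def fill (X : STree (ℤ × Val) × List (Message (ℤ × Val))) (F : Frame) :
    STree (ℤ × Val) × List (Message (ℤ × Val)) :=
  if F.right then (.balance F.l F.x X.1, .reveal F.x :: .answer .gt :: X.2)
  else (.balance X.1 F.x F.r, .reveal F.x :: .answer .lt :: X.2)

end Frame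

/-- Messages as data. -/
def msgsVal (l : List (Message (ℤ × Val))) : Val := Val.ofList (Message.toVal Prod.snd) l

lemma truth_isPair (s : Store) (e : Expr) :
    ((Expr.isPair e).eval s).truth = true ↔ ∃ a b, e.eval s = .pair a b := by
  cases h : e.eval s <;> simp [Expr.eval, h]

lemma isPair_augVal {s : Store} {e : Expr} {t : STree (ℤ × Val)} (h : e.eval s = augVal t) :
    ((Expr.isPair e).eval s).truth = true ↔ t ≠ .leaf := by
  rw [truth_isPair, h]
  cases t <;> simp [augVal]

namespace Cmd

open MOPED.Expr in
/-- One step of the walk down: register 9 holds the current subtree, register 8 the stack of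
ancestors, register 10 the plaintext to be inserted.  If the plaintext is found, then registers
2 and 7 get the subtree and the messages exchanged at its root. -/
def walkDown : Cmd :=
  ite (le (var 10) (rootPt (var 9)))
    (ite (le (rootPt (var 9)) (var 10))
      (block [assign 2 (var 9),
        assign 7 (pair (pair (lit 1) (rootCt (var 9))) (pair (pair (lit 2) (lit 0)) nil)),
        assign 9 nil])
      (block [assign 8 (pair (pair nil (var 9)) (var 8)), assign 9 (left (var 9))]))
    (block [assign 8 (pair (pair (lit 1) (var 9)) (var 8)), assign 9 (right (var 9))])

open MOPED.Expr in
/-- One step of the way back up: register 2 holds the new subtree, register 7 the messages. -/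
def walkUp : Cmd :=
  block [assign 9 (snd (fst (var 8))),
    ite (fst (fst (var 8)))
      (block [assign 3 (left (var 9)), assign 6 (var 2),
        assign 7 (pair (pair (lit 1) (rootCt (var 9))) (pair (pair (lit 2) (lit 1)) (var 7)))])
      (block [assign 3 (var 2), assign 6 (right (var 9)),
        assign 7 (pair (pair (lit 1) (rootCt (var 9))) (pair (pair (lit 2) (lit (-1))) (var 7)))]),
    assign 4 (rootPt (var 9)), assign 5 (rootCt (var 9)), assign 8 (snd (var 8)), balanceNode]

open MOPED.Expr in
/-- Inserts the plaintext in register 10 with the ciphertext in register 11 into the tree in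
register 12.  The new tree is put into register 2, the messages exchanged into register 7. -/
def walk : Cmd :=
  seq (block [assign 9 (var 12), assign 8 nil, assign 7 nil, assign 2 nil])
    (seq (loop (isPair (var 9)) walkDown)
      (seq (ite (isPair (var 2)) skip (mkNode 2 nil (var 10) (var 11) nil))
        (loop (isPair (var 8)) walkUp)))

end Cmd

/-- A pending result `X` under the ancestors `fs` is stored, and the whole walk results in `W`. -/
def Pending (s₀ : Store) (W : STree (ℤ × Val) × List (Message (ℤ × Val))) (n : ℕ)
    (fs : List Frame) (X : STree (ℤ × Val) × List (Message (ℤ × Val))) (s : Store) : Prop :=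
  (∀ i, 10 ≤ i → s i = s₀ i) ∧ s 8 = Val.ofList Frame.toVal fs ∧ s 7 = msgsVal X.2 ∧
    fs.foldl Frame.fill X = W ∧ fs.length ≤ n

section

variable {ρ : Val → Val → Prop} {s₀ : Store} {W : STree (ℤ × Val) × List (Message (ℤ × Val))}

lemma exec_walkDown {y : ℤ × Val} (hy : s₀ 10 = .int y.1) {n : ℕ} (t : STree (ℤ × Val))
    (ht : t.size ≤ n) {s : Store} (h9 : s 9 = augVal t) (h8 : s 8 = .nil) (h7 : s 7 = .nil)
    (h2 : s 2 = .nil) (hs : ∀ i, 10 ≤ i → s i = s₀ i) :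
    Exec ρ (.loop (.isPair (.var 9)) .walkDown) s (t.size * (Cmd.walkDown.cost + 1) + 1) fun s' =>
      ∃ fs X, Pending s₀ (t.walk (cmpPt y) y) n fs X s' ∧
        ((s' 2 = augVal X.1 ∧ X.1 ≠ .leaf) ∨ (s' 2 = .nil ∧ X.1 = .mk .leaf y .leaf)) := by
  set W := t.walk (cmpPt y) y with hWdef
  refine Exec.loop (fun j s =>
    (∃ (t : STree (ℤ × Val)) (fs : List Frame), t.size = j ∧ s 9 = augVal t ∧ s 2 = .nil ∧
      s 7 = .nil ∧ (∀ i, 10 ≤ i → s i = s₀ i) ∧ s 8 = Val.ofList Frame.toVal fs ∧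
      fs.foldl Frame.fill (t.walk (cmpPt y) y) = W ∧ fs.length + t.size ≤ n) ∨
    (s 9 = .nil ∧ ∃ fs X, Pending s₀ W n fs X s ∧ s 2 = augVal X.1 ∧ X.1 ≠ .leaf)) ?_ _ _
    (Or.inl ⟨t, [], rfl, h9, h2, h7, hs, h8, rfl, by simpa using ht⟩)
  clear_value W
  rintro j s (⟨t, fs, rfl, h9, h2, h7, hfr, h8, hW, hn⟩ | ⟨h9, fs, X, hP, h2⟩)
  · rcases t with _ | ⟨h, l, x, r⟩
    · refine Or.inl ⟨by simp [Expr.eval, h9, augVal], fs, _, ⟨hfr, h8, ?_, hW, by omega⟩,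
        Or.inr ⟨h2, rfl⟩⟩
      rw [h7]; rfl
    refine Or.inr ⟨by simp [Expr.eval, h9, augVal], ?_⟩
    have h10 : s 10 = .int y.1 := (hfr 10 le_rfl).trans hy
    simp only [STree.size] at hn
    have hupd : ∀ {a b : ℕ} {v w : Val}, a < 10 → b < 10 → ∀ i, 10 ≤ i →
        Function.update (Function.update s a v) b w i = s₀ i := by
      intro a b v w ha hb i hi
      rw [Function.update_of_ne (by omega), Function.update_of_ne (by omega), hfr i hi]
    rcases lt_trichotomy y.1 x.1 with hlt | heq | hgt
    · have hcmp : cmpPt y x = .lt := compare_lt_iff_lt.2 hlt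
      have he : Cmd.walkDown.effect s =
          Function.update (Function.update s 8 (.pair (.pair .nil (s 9)) (s 8))) 9
            (augVal l) := by
        simp [Cmd.walkDown, Cmd.effect, Cmd.block, Expr.eval, Expr.left, Expr.rootPt, h9, h10,
          augVal, Val.fst, Val.snd, hlt.le, not_le.2 hlt]
      refine ⟨l.size, by simp only [STree.size]; omega, .simple rfl le_rfl
        (Or.inl ⟨l, ⟨false, h, l, x, r⟩ :: fs, rfl, ?_⟩)⟩
      rw [he]
      refine ⟨by simp, by simp [h2], by simp [h7], hupd (by omega) (by omega), ?_, ?_, ?_⟩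
      · simp [h8, h9, Val.ofList, Frame.toVal, Val.ofBool]
      · rw [← hW]
        simp [STree.walk, hcmp, Frame.fill]
      · simp only [List.length_cons]; omega
    · have hcmp : cmpPt y x = .eq := compare_eq_iff_eq.2 heq
      have he : Cmd.walkDown.effect s =
          Function.update (Function.update (Function.update s 2 (s 9)) 7
            (msgsVal [.reveal x, .answer .eq])) 9 .nil := by
        simp [Cmd.walkDown, Cmd.effect, Cmd.block, Expr.eval, Expr.rootPt, Expr.rootCt,
          Expr.display, h9, h10, augVal, STree.toVal, Val.fst, Val.snd, heq, msgsVal, Val.ofList,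
          Message.toVal, orderingVal]
      refine ⟨0, by simp only [STree.size]; omega, .simple rfl le_rfl
        (Or.inr ⟨?_, fs, (.node h l x r, [.reveal x, .answer .eq]), ⟨?_, ?_, ?_, ?_, ?_⟩, ?_⟩)⟩
      · simp [he]
      · intro i hi
        rw [he, Function.update_of_ne (by omega), Function.update_of_ne (by omega),
          Function.update_of_ne (by omega), hfr i hi]
      · simp [he, h8]
      · simp [he]
      · rw [← hW]
        simp [STree.walk, hcmp]
      · omega
      · simp [he, h9]
    · have hcmp : cmpPt y x = .gt := compare_gt_iff_gt.2 hgt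
      have he : Cmd.walkDown.effect s =
          Function.update (Function.update s 8 (.pair (.pair (.int 1) (s 9)) (s 8))) 9
            (augVal r) := by
        simp [Cmd.walkDown, Cmd.effect, Cmd.block, Expr.eval, Expr.right, Expr.rootPt, h9, h10,
          augVal, Val.fst, Val.snd, not_le.2 hgt]
      refine ⟨r.size, by simp only [STree.size]; omega, .simple rfl le_rfl
        (Or.inl ⟨r, ⟨true, h, l, x, r⟩ :: fs, rfl, ?_⟩)⟩
      rw [he]
      refine ⟨by simp, by simp [h2], by simp [h7], hupd (by omega) (by omega), ?_, ?_, ?_⟩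
      · simp [h8, h9, Val.ofList, Frame.toVal, Val.ofBool]
      · rw [← hW]
        simp [STree.walk, hcmp, Frame.fill]
      · simp only [List.length_cons]; omega
  · exact Or.inl ⟨by simp [Expr.eval, h9], fs, X, hP, Or.inl h2⟩

lemma effect_walkUp {F : Frame} {v : Val} {X : STree (ℤ × Val) × List (Message (ℤ × Val))}
    {s : Store} (h8 : s 8 = .pair F.toVal v) (h7 : s 7 = msgsVal X.2) (h2 : s 2 = augVal X.1) :
    Cmd.walkUp.effect s 2 = augVal (F.fill X).1 ∧ Cmd.walkUp.effect s 7 = msgsVal (F.fill X).2 ∧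
      Cmd.walkUp.effect s 8 = v ∧ ∀ i, 10 ≤ i → Cmd.walkUp.effect s i = s i := by
  obtain ⟨b, h, l, x, r⟩ := F
  have key : ∀ (tl tr : STree (ℤ × Val)) (ms : Val),
      (if b then augVal l else augVal X.1) = augVal tl →
      (if b then augVal X.1 else augVal r) = augVal tr →
      Val.pair (.pair (.int 1) x.2) (.pair (.pair (.int 2) (.int (if b then 1 else -1))) (s 7)) =
        ms →
      Cmd.walkUp.effect s 2 = augVal (.balance tl x tr) ∧ Cmd.walkUp.effect s 7 = ms ∧
        Cmd.walkUp.effect s 8 = v ∧ ∀ i, 10 ≤ i → Cmd.walkUp.effect s i = s i := by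
    intro tl tr ms htl htr hms
    obtain ⟨s', hs', h3', h4', h5', h6', h7', h8', hfr⟩ : ∃ s', Cmd.walkUp.effect s =
        Cmd.balanceNode.effect s' ∧ s' 3 = augVal tl ∧ s' 4 = .int x.1 ∧ s' 5 = x.2 ∧
        s' 6 = augVal tr ∧ s' 7 = ms ∧ s' 8 = v ∧ ∀ i, 10 ≤ i → s' i = s i := by
      refine ⟨_, rfl, ?_⟩
      cases b
      all_goals
        simp [Cmd.block, Cmd.effect, Expr.eval, Expr.left, Expr.right, Expr.rootPt,
          Expr.rootCt, Expr.display, h8, Frame.toVal, augVal, STree.toVal, Val.fst, Val.snd, h2]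
        refine ⟨by simpa using htl, by simpa using htr, by simpa using hms, fun i hi => ?_⟩
        iterate 7 rw [Function.update_of_ne (by omega)]
    obtain ⟨e₁, e₂⟩ := Cmd.effect_balanceNode h3' h4' h5' h6'
    rw [hs']
    exact ⟨e₁, (e₂ 7 (by omega)).trans h7', (e₂ 8 (by omega)).trans h8',
      fun i hi => (e₂ i (by omega)).trans (hfr i hi)⟩
  cases b
  · exact key X.1 r _ rfl rfl (by rw [h7]; rfl)
  · exact key l X.1 _ rfl rfl (by rw [h7]; rfl)

lemma exec_walkUp {n : ℕ} {fs : List Frame} {X : STree (ℤ × Val) × List (Message (ℤ × Val))}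
    {s : Store} (hP : Pending s₀ W n fs X s) (h2 : s 2 = augVal X.1) :
    Exec ρ (.loop (.isPair (.var 8)) .walkUp) s (n * (Cmd.walkUp.cost + 1) + 1) fun s' =>
      s' 2 = augVal W.1 ∧ s' 7 = msgsVal W.2 ∧ ∀ i, 10 ≤ i → s' i = s₀ i := by
  refine Exec.loop (fun j s => ∃ fs X, fs.length ≤ j ∧ Pending s₀ W n fs X s ∧ s 2 = augVal X.1)
    ?_ _ _ ⟨fs, X, hP.2.2.2.2, hP, h2⟩
  rintro j s ⟨fs, X, hj, ⟨hfr, h8, h7, hW, hn⟩, h2⟩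
  cases fs with
  | nil =>
    obtain rfl : X = W := hW
    exact Or.inl ⟨by simp [Expr.eval, h8, Val.ofList], h2, h7, hfr⟩
  | cons F fs =>
    simp only [List.length_cons] at hj hn
    obtain ⟨e2, e7, e8, e⟩ := effect_walkUp h8 h7 h2
    exact Or.inr ⟨by simp [Expr.eval, h8, Val.ofList], fs.length, by omega, .simple rfl le_rfl
      ⟨fs, F.fill X, le_rfl, ⟨fun i hi => (e i hi).trans (hfr i hi), e8, e7, hW, by omega⟩, e2⟩⟩

/-- The running time of an insertion into a tree with `n` nodes. -/
def walkTime (n : ℕ) : ℕ := n * (Cmd.walkDown.cost + Cmd.walkUp.cost + 2) + 30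

lemma walkTime_mono {m n : ℕ} (h : m ≤ n) : walkTime m ≤ walkTime n := by
  unfold walkTime; gcongr

lemma exec_walk {y : ℤ × Val} {t : STree (ℤ × Val)} (h10 : s₀ 10 = .int y.1) (h11 : s₀ 11 = y.2)
    (h12 : s₀ 12 = augVal t) :
    Exec ρ .walk s₀ (walkTime t.size) fun s' =>
      s' 2 = augVal (t.walk (cmpPt y) y).1 ∧ s' 7 = msgsVal (t.walk (cmpPt y) y).2 ∧
        ∀ i, 10 ≤ i → s' i = s₀ i := by
  have h₁ : Exec ρ (Cmd.block [.assign 9 (.var 12), .assign 8 .nil, .assign 7 .nil, .assign 2 .nil])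
      s₀ 7 fun s => s 9 = augVal t ∧ s 8 = .nil ∧ s 7 = .nil ∧ s 2 = .nil ∧
        ∀ i, 10 ≤ i → s i = s₀ i := by
    refine .simple rfl le_rfl ?_
    simp only [Cmd.block, Cmd.effect, Expr.eval]
    refine ⟨by simp [h12], by simp, by simp, by simp, fun i hi => ?_⟩
    rw [Function.update_of_ne (by omega), Function.update_of_ne (by omega),
      Function.update_of_ne (by omega), Function.update_of_ne (by omega)]
  refine Exec.mono (h₁.seq fun s ⟨h9, h8, h7, h2, hfr⟩ =>
    (exec_walkDown h10 t le_rfl h9 h8 h7 h2 hfr).seq fun s ⟨fs, X, hP, hX⟩ => Exec.seq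
      (P' := fun s' => Pending s₀ (t.walk (cmpPt y) y) t.size fs X s' ∧ s' 2 = augVal X.1)
      (n₁ := 3) ?_ fun s ⟨hP, h2⟩ => exec_walkUp hP h2) ?_ fun _ h => h
  · refine .simple rfl le_rfl ?_
    rcases hX with ⟨h2, hne⟩ | ⟨h2, hX⟩
    · have ht := (isPair_augVal (e := .var 2) h2).2 hne
      simp only [Cmd.effect, ht, cond_true]
      exact ⟨hP, h2⟩
    · have ht : ((Expr.isPair (.var 2)).eval s).truth = false := by simp [Expr.eval, h2]
      have hm : (Expr.var 10).eval s = .int y.1 := (hP.1 10 (by omega)).trans h10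
      have hc : (Expr.var 11).eval s = y.2 := (hP.1 11 (by omega)).trans h11
      rw [Cmd.effect, ht, Cmd.effect_mkNode (tl := .leaf) (tr := .leaf) rfl hm hc rfl, hX]
      obtain ⟨p₁, p₂, p₃, p₄, p₅⟩ := hP
      refine ⟨⟨fun i hi => ?_, ?_, ?_, p₄, p₅⟩, by simp⟩
      · simpa [Function.update_of_ne (show i ≠ 2 by omega)] using p₁ i hi
      · simpa using p₂
      · simpa using p₃
  · unfold walkTime
    rw [show t.size * (Cmd.walkDown.cost + Cmd.walkUp.cost + 2) =
      t.size * (Cmd.walkDown.cost + 1) + t.size * (Cmd.walkUp.cost + 1) by ring]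
    omega

end

/-! ### The challenger as a program -/

lemma toIntList_eq_nil {v : Val} (h : v.toIntList = []) : ∀ a b, v ≠ .pair a b := by
  rintro a b rfl
  simp [Val.toIntList] at h

lemma toIntList_eq_cons {v : Val} {d : ℤ} {D : List ℤ} (h : v.toIntList = d :: D) :
    ∃ a b, v = .pair a b ∧ a.toInt = d ∧ b.toIntList = D := by
  cases v with
  | nil => simp [Val.toIntList] at h
  | int z => simp [Val.toIntList] at h
  | pair a b =>
    simp only [Val.toIntList, List.cons.injEq] at h
    exact ⟨a, b, rfl, h.1, h.2⟩

/-- A list of pairs of integers as data. -/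
def pairsVal (L : List (ℤ × ℤ)) : Val := Val.ofList (fun p => .pair (.int p.1) (.int p.2)) L

/-- What the adversary sees of one insertion, as data. -/
def itemVal (p : List (Message (ℤ × Val)) × STree (ℤ × Val)) : Val :=
  .pair (msgsVal p.1) (p.2.toVal Prod.snd)

namespace Cmd

open MOPED.Expr in
/-- Clears register 9 if the oracle does not encrypt the values for the displacement that comes
first in register 8. -/
def checkOne : Cmd :=
  seq (send 10 (add (var 17) (fst (var 8)))) (seq (send 11 (add (var 18) (fst (var 8))))
    (block [ite (var 10) skip (assign 9 nil), ite (var 11) skip (assign 9 nil),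
      assign 8 (snd (var 8))]))

open MOPED.Expr in
/-- Records the pair of values for the displacement that comes first in register 13, and asks for
the encryption of the one that is selected by the bit in register 21. -/
def prepareOne : Cmd :=
  block [assign 15 (pair (pair (add (var 17) (fst (var 13))) (add (var 18) (fst (var 13))))
      (var 15)),
    ite (var 21) (assign 10 (add (var 18) (fst (var 13))))
      (assign 10 (add (var 17) (fst (var 13))))]

open MOPED.Expr in
/-- Keeps the new tree, and puts what the adversary sees in front of register 14. -/
def recordOne : Cmd :=
  block [assign 12 (var 2),
    assign 14 (pair (pair (pair (pair (lit 0) (var 11)) (var 7)) (display (var 2))) (var 14)),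
    assign 13 (snd (var 13))]

open MOPED.Expr in
/-- Inserts the value for the displacement that comes first in register 13. -/
def playOne : Cmd :=
  seq prepareOne (seq (send 11 (var 10)) (seq walk recordOne))

open MOPED.Expr in
/-- Moves the first entry of register 14 to the front of register 23. -/
def reverseOne : Cmd :=
  block [assign 23 (pair (fst (var 14)) (var 23)), assign 14 (snd (var 14))]

open MOPED.Expr in
/-- Plays the role of the challenger: register 22 holds the message of the adversary, register 23
receives the reply.  The tree is in register 12, all pairs of values so far in register 15, the
displacements in register 16 (if register 20 is true), the bit in register 21. -/
def respond : Cmd :=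
  ite (var 20)
    (seq (block [assign 17 (add (fst (var 22)) (lit 0)), assign 18 (add (snd (var 22)) (lit 0)),
        assign 8 (pair (lit 0) (var 16)), assign 9 (lit 1)])
      (seq (loop (isPair (var 8)) checkOne)
        (ite (var 9)
          (seq (block [assign 23 nil, assign 13 (pair (lit 0) (var 16)), assign 14 nil])
            (seq (loop (isPair (var 13)) playOne) (loop (isPair (var 14)) reverseOne)))
          (assign 23 nil))))
    (block [assign 16 (var 22), assign 20 (lit 1), assign 23 nil])

end Cmd

section

variable {ρ : Val → Val → Prop} {s₀ : Store}

/-- The oracle may encrypt `z`. -/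
def Accepts (ρ : Val → Val → Prop) (z : ℤ) : Prop := ∃ r, ρ (.int z) r ∧ r.truth = true

/-- The oracle may refuse to encrypt `z`. -/
def Refuses (ρ : Val → Val → Prop) (z : ℤ) : Prop := ∃ r, ρ (.int z) r ∧ r.truth = false

lemma exec_check {D : List ℤ} {v w : ℤ} (hv : (s₀ 17).toInt = v) (hw : (s₀ 18).toInt = w)
    {s : Store} (h8 : (s 8).toIntList = D) (h9 : (s 9).truth = true)
    (hs : ∀ i, 12 ≤ i → s i = s₀ i) :
    Exec ρ (.loop (.isPair (.var 8)) .checkOne) s (D.length * 12 + 1) fun s' =>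
      (∀ i, 12 ≤ i → s' i = s₀ i) ∧
      (((s' 9).truth = true ∧ ∀ d ∈ D, Accepts ρ (v + d) ∧ Accepts ρ (w + d)) ∨
        ((s' 9).truth = false ∧ ∃ d ∈ D, Refuses ρ (v + d) ∨ Refuses ρ (w + d))) := by
  refine Exec.loop (n := 11) (fun j s => ∃ E F : List ℤ, F.length = j ∧ E ++ F = D ∧
    (s 8).toIntList = F ∧ (∀ i, 12 ≤ i → s i = s₀ i) ∧
    (((s 9).truth = true ∧ ∀ d ∈ E, Accepts ρ (v + d) ∧ Accepts ρ (w + d)) ∨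
      ((s 9).truth = false ∧ ∃ d ∈ D, Refuses ρ (v + d) ∨ Refuses ρ (w + d)))) ?_ _ _
    ⟨[], D, rfl, rfl, h8, hs, Or.inl ⟨h9, by simp⟩⟩
  rintro _ s ⟨E, F, rfl, hD, h8, hfr, h9⟩
  rcases F with _ | ⟨d, F⟩
  · refine Or.inl ⟨?_, hfr, ?_⟩
    · rw [← Bool.not_eq_true, truth_isPair]
      rintro ⟨a, b, h⟩
      exact toIntList_eq_nil h8 a b h
    · rw [List.append_nil] at hD
      rwa [hD] at h9
  · obtain ⟨a, b, hab, ha, hb⟩ := toIntList_eq_cons h8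
    refine Or.inr ⟨(truth_isPair _ _).2 ⟨a, b, hab⟩, F.length, by simp, ?_⟩
    have h17 : (s 17).toInt = v := by rw [hfr 17 (by omega), hv]
    have h18 : (s 18).toInt = w := by rw [hfr 18 (by omega), hw]
    refine Exec.mono (n := 1 + (1 + 7 + 1) + 1)
      ((Exec.send (P := fun s' => ∃ r, ρ (.int (v + d)) r ∧ s' = Function.update s 10 r)
        fun r hr => ⟨r, ?_, rfl⟩).seq ?_) le_rfl fun _ h => h
    · simpa [Expr.eval, h17, hab, Val.fst, ha] using hr
    rintro _ ⟨r, hr, rfl⟩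
    refine Exec.seq (n₁ := 1) (n₂ := 7) (Exec.send (P := fun s' => ∃ r', ρ (.int (w + d)) r' ∧
      s' = Function.update (Function.update s 10 r) 11 r') fun r' hr' => ⟨r', ?_, rfl⟩) ?_
    · simpa [Expr.eval, h18, hab, Val.fst, ha] using hr'
    rintro _ ⟨r', hr', rfl⟩
    refine .simple rfl (by decide) ⟨E ++ [d], F, rfl, by simp [hD], ?_⟩
    have hdD : d ∈ D := by rw [← hD]; simp
    have he : (Cmd.block [.ite (.var 10) .skip (.assign 9 .nil), .ite (.var 11) .skip
        (.assign 9 .nil), .assign 8 (.snd (.var 8))]).effect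
          (Function.update (Function.update s 10 r) 11 r') =
        Function.update (bif r.truth && r'.truth then
          Function.update (Function.update s 10 r) 11 r' else
            Function.update (Function.update (Function.update s 10 r) 11 r') 9 .nil) 8 b := by
      rcases hrt : r.truth <;> rcases hrt' : r'.truth <;>
        simp [Cmd.block, Cmd.effect, Expr.eval, hrt, hrt', hab, Val.snd]
    rw [he]
    refine ⟨by simpa using hb, fun i hi => ?_, ?_⟩
    · rw [Function.update_of_ne (by omega)]
      cases r.truth && r'.truth
      · simp only [cond_false]
        rw [Function.update_of_ne (by omega), Function.update_of_ne (by omega),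
          Function.update_of_ne (by omega), hfr i hi]
      · simp only [cond_true]
        rw [Function.update_of_ne (by omega), Function.update_of_ne (by omega), hfr i hi]
    rw [Function.update_of_ne (by omega)]
    rcases hrt : r.truth
    · exact Or.inr ⟨by simp [Val.truth], d, hdD, Or.inl ⟨r, hr, hrt⟩⟩
    rcases hrt' : r'.truth
    · exact Or.inr ⟨by simp [Val.truth], d, hdD, Or.inr ⟨r', hr', hrt'⟩⟩
    · refine h9.imp (fun h => ⟨by simpa using h.1, fun x hx => ?_⟩)
        fun h => ⟨by simpa using h.1, h.2⟩
      rcases List.mem_append.1 hx with hx | hx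
      · exact h.2 x hx
      · rw [List.mem_singleton.1 hx]
        exact ⟨⟨r, hr, hrt⟩, r', hr', hrt'⟩

lemma exec_reverse {α : Type} (f : α → Val) (l : List α) {s : Store} {l' : List α}
    (h14 : s 14 = Val.ofList f l) (h23 : s 23 = Val.ofList f l') :
    Exec ρ (.loop (.isPair (.var 14)) .reverseOne) s (l.length * 4 + 1) fun s' =>
      s' 23 = Val.ofList f (l.reverse ++ l') ∧ ∀ i, i ≠ 14 → i ≠ 23 → s' i = s i := by
  refine Exec.loop (n := 3) (fun j s' => ∃ m m' : List α, m.length = j ∧ s' 14 = Val.ofList f m ∧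
    s' 23 = Val.ofList f m' ∧ m.reverse ++ m' = l.reverse ++ l' ∧
    ∀ i, i ≠ 14 → i ≠ 23 → s' i = s i) ?_ _ _ ⟨l, l', rfl, h14, h23, rfl, fun _ _ _ => rfl⟩
  rintro _ s' ⟨m, m', rfl, h14, h23, hm, hfr⟩
  rcases m with _ | ⟨a, m⟩
  · refine Or.inl ⟨by simp [Expr.eval, h14, Val.ofList], ?_, hfr⟩
    rw [← hm, h23]; rfl
  · refine Or.inr ⟨by simp [Expr.eval, h14, Val.ofList], m.length, by simp,
      .simple rfl le_rfl ⟨m, a :: m', rfl, ?_, ?_, by simpa using hm, fun i hi hi' => ?_⟩⟩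
    · simp [Cmd.reverseOne, Cmd.block, Cmd.effect, Expr.eval, h14, Val.ofList, Val.snd]
    · simp [Cmd.reverseOne, Cmd.block, Cmd.effect, Expr.eval, h14, h23, Val.ofList, Val.fst]
    · simp only [Cmd.reverseOne, Cmd.block, Cmd.effect]
      rw [Function.update_of_ne hi, Function.update_of_ne hi', hfr i hi hi']

lemma exec_play {D : List ℤ} {v w : ℤ} {b : Bool} {t : STree (ℤ × Val)} {L : List (ℤ × ℤ)}
    {n : ℕ} (hn : t.size + D.length ≤ n)
    (hv : (s₀ 17).toInt = v) (hw : (s₀ 18).toInt = w) (hb : s₀ 21 = Val.ofBool b)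
    (h12 : s₀ 12 = augVal t) (h13 : (s₀ 13).toIntList = D) (h14 : s₀ 14 = .nil)
    (h15 : s₀ 15 = pairsVal L) :
    Exec ρ (.loop (.isPair (.var 13)) .playOne) s₀ (D.length * (walkTime n + 15) + 1) fun s =>
      (∃ ys : List (ℤ × Val), ys.map Prod.fst = D.map (fun d => side b (v + d, w + d)) ∧
        (∀ y ∈ ys, ρ (.int y.1) y.2) ∧ s 12 = augVal (STree.insertList cmpPt ys t).1 ∧
        s 14 = Val.ofList itemVal (STree.insertList cmpPt ys t).2.reverse) ∧
      s 15 = pairsVal ((D.map fun d => (v + d, w + d)).reverse ++ L) ∧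
      ∀ i, 16 ≤ i → s i = s₀ i := by
  refine Exec.loop (n := walkTime n + 14) (fun j s => ∃ E F : List ℤ, F.length = j ∧ E ++ F = D ∧
    (s 13).toIntList = F ∧
    (∃ ys : List (ℤ × Val), ys.map Prod.fst = E.map (fun d => side b (v + d, w + d)) ∧
        (∀ y ∈ ys, ρ (.int y.1) y.2) ∧ s 12 = augVal (STree.insertList cmpPt ys t).1 ∧
        s 14 = Val.ofList itemVal (STree.insertList cmpPt ys t).2.reverse) ∧
      s 15 = pairsVal ((E.map fun d => (v + d, w + d)).reverse ++ L) ∧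
      ∀ i, 16 ≤ i → s i = s₀ i) ?_ _ _
    ⟨[], D, rfl, rfl, h13, ⟨[], rfl, by simp, h12, h14⟩, h15, fun _ _ => rfl⟩
  rintro _ s ⟨E, F, rfl, hD, g13, ⟨ys, hys, hρ, g12, g14⟩, g15, hfr⟩
  rcases F with _ | ⟨d, F⟩
  · rw [List.append_nil] at hD
    subst hD
    refine Or.inl ⟨?_, ⟨ys, hys, hρ, g12, g14⟩, g15, hfr⟩
    rw [← Bool.not_eq_true, truth_isPair]
    rintro ⟨a, b, h⟩
    exact toIntList_eq_nil g13 a b h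
  obtain ⟨a, c, hac, ha, hc⟩ := toIntList_eq_cons g13
  refine Or.inr ⟨(truth_isPair _ _).2 ⟨a, c, hac⟩, F.length, by simp, ?_⟩
  have h17 : (s 17).toInt = v := by rw [hfr 17 (by omega), hv]
  have h18 : (s 18).toInt = w := by rw [hfr 18 (by omega), hw]
  have h21 : s 21 = Val.ofBool b := by rw [hfr 21 (by omega), hb]
  set y : ℤ := side b (v + d, w + d) with hy
  set T := STree.insertList cmpPt ys t with hT
  have hsize : T.1.size ≤ n := by
    have h₁ := STree.size_insertList_le cmpPt ys t
    have h₂ : ys.length = E.length := by simpa using congrArg List.length hys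
    rw [← hD, List.length_append] at hn
    rw [← hT] at h₁
    omega
  refine Exec.mono (n := 5 + (1 + (walkTime n + 5 + 1) + 1) + 1) (Exec.seq (P' := fun s' =>
      s' 10 = .int y ∧ s' 12 = s 12 ∧ s' 13 = s 13 ∧ s' 14 = s 14 ∧
      s' 15 = pairsVal (((E ++ [d]).map fun d => (v + d, w + d)).reverse ++ L) ∧
      ∀ i, 16 ≤ i → s' i = s₀ i) (.simple rfl (by decide) ?_) ?_) (by omega) fun _ h => h
  · have he : Cmd.prepareOne.effect s =
        Function.update (Function.update s 15 (.pair (.pair (.int (v + d)) (.int (w + d))) (s 15)))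
          10 (.int y) := by
      cases b <;>
        simp [Cmd.prepareOne, Cmd.block, Cmd.effect, Expr.eval, hac, Val.fst, ha, h17, h18, h21, hy,
          side]
    rw [he]
    refine ⟨by simp, by simp, by simp, by simp, ?_, fun i hi => ?_⟩
    · simp [g15, pairsVal, Val.ofList]
    · rw [Function.update_of_ne (by omega), Function.update_of_ne (by omega), hfr i hi]
  rintro s₁ ⟨k10, k12, k13, k14, k15, kfr⟩
  refine Exec.seq (P' := fun s' => ∃ r, ρ (.int y) r ∧ s' = Function.update s₁ 11 r)
    (Exec.send fun r hr => ⟨r, by simpa [Expr.eval, k10] using hr, rfl⟩) ?_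
  rintro _ ⟨r, hr, rfl⟩
  refine Exec.seq ((exec_walk (y := (y, r)) (t := T.1) (by simp [k10]) (by simp)
    (by simp [k12, g12])).mono (walkTime_mono hsize) fun _ h => h) ?_
  rintro s₂ ⟨l2, l7, lfr⟩
  refine .simple rfl (by decide) ⟨E ++ [d], F, rfl, by simp [hD], ?_,
    ⟨ys ++ [(y, r)], ?_, ?_, ?_, ?_⟩, ?_, fun i hi => ?_⟩
  · simp [Cmd.recordOne, Cmd.block, Cmd.effect, Expr.eval, lfr, k13, hac, Val.snd, hc]
  · simp [hys, hy]
  · intro z hz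
    rcases List.mem_append.1 hz with hz | hz
    · exact hρ z hz
    · rw [List.mem_singleton.1 hz]
      exact hr
  · rw [STree.insertList_append]
    simp [Cmd.recordOne, Cmd.block, Cmd.effect, Expr.eval, l2, STree.insertList, ← hT]
  · rw [STree.insertList_append]
    have hdisp := Expr.eval_display (s := Function.update s₂ 12 (s₂ 2)) (e := .var 2)
      (t := (T.1.walk (cmpPt (y, r)) (y, r)).1) (by simp [Expr.eval, l2])
    simp [Cmd.recordOne, Cmd.block, Cmd.effect, Expr.eval, lfr, k14, g14, l7, hdisp,
      STree.insertList, Val.ofList, itemVal, msgsVal, Message.toVal, ← hT]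
  · simp [Cmd.recordOne, Cmd.block, Cmd.effect, lfr, k15]
  · simp only [Cmd.recordOne, Cmd.block, Cmd.effect]
    rw [Function.update_of_ne (by omega), Function.update_of_ne (by omega),
      Function.update_of_ne (by omega), lfr i (by omega),
      Function.update_of_ne (by omega), kfr i hi]

end

/-- The registers hold the state of the challenger: its bit, the displacements, all pairs of values
so far, and the tree. -/
structure Holds (s : Store) (b : Bool) (disp : Option (List ℤ)) (L : List (ℤ × ℤ))
    (t : STree (ℤ × Val)) : Prop where
  tree : s 12 = augVal t
  pairs : s 15 = pairsVal L
  bit : s 21 = Val.ofBool b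
  started : (s 20).truth = disp.isSome
  disp : ∀ D, disp = some D → (s 16).toIntList = D

/-- The time for a reply of the challenger if there are `d` displacements and if the tree has
at most `n` nodes afterwards. -/
def respondTime (d n : ℕ) : ℕ := (d + 1) * (walkTime n + 31) + 30

lemma respondTime_mono {d d' n n' : ℕ} (hd : d ≤ d') (hn : n ≤ n') :
    respondTime d n ≤ respondTime d' n' := by
  have := walkTime_mono hn
  unfold respondTime
  gcongr

section

variable {ρ : Val → Val → Prop} {s₀ : Store} {b : Bool} {L : List (ℤ × ℤ)} {t : STree (ℤ × Val)}

lemma exec_respond_none (h : Holds s₀ b none L t) (d n : ℕ) :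
    Exec ρ .respond s₀ (respondTime d n) fun s =>
      Holds s b (some (s₀ 22).toIntList) L t ∧ s 23 = .nil ∧ ∀ i, 24 ≤ i → s i = s₀ i := by
  have h20 : (s₀ 20).truth = false := h.started
  refine Exec.mono (n := 5 + 1) (Exec.ite (fun ht => ?_) fun _ => .simple rfl le_rfl ?_)
    (by unfold respondTime; omega) fun _ h => h
  · simp [Expr.eval, h20] at ht
  · simp only [Cmd.block, Cmd.effect, Expr.eval]
    refine ⟨⟨?_, ?_, ?_, ?_, ?_⟩, ?_, fun i hi => ?_⟩
    · simp [h.tree]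
    · simp [h.pairs]
    · simp [h.bit]
    · simp [Val.truth]
    · rintro D ⟨⟩
      simp
    · simp
    · rw [Function.update_of_ne (by omega), Function.update_of_ne (by omega),
        Function.update_of_ne (by omega)]

lemma exec_respond_some {D : List ℤ} (h : Holds s₀ b (some D) L t) {n : ℕ}
    (hn : t.size + (D.length + 1) ≤ n) :
    Exec ρ .respond s₀ (respondTime D.length n) fun s =>
      (∀ i, 24 ≤ i → s i = s₀ i) ∧
      (((∃ d ∈ 0 :: D, Refuses ρ ((s₀ 22).fst.toInt + d) ∨ Refuses ρ ((s₀ 22).snd.toInt + d)) ∧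
          Holds s b (some D) L t ∧ s 23 = .nil) ∨
        ((∀ d ∈ 0 :: D, Accepts ρ ((s₀ 22).fst.toInt + d) ∧ Accepts ρ ((s₀ 22).snd.toInt + d)) ∧
          ∃ ys : List (ℤ × Val),
            ys.map Prod.fst =
              (0 :: D).map (fun d => side b ((s₀ 22).fst.toInt + d, (s₀ 22).snd.toInt + d)) ∧
            (∀ y ∈ ys, ρ (.int y.1) y.2) ∧
            Holds s b (some D)
              (((0 :: D).map fun d => ((s₀ 22).fst.toInt + d, (s₀ 22).snd.toInt + d)).reverse ++ L)
              (STree.insertList cmpPt ys t).1 ∧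
            s 23 = viewOf Prod.snd (STree.insertList cmpPt ys t).2)) := by
  set v := (s₀ 22).fst.toInt with hv
  set w := (s₀ 22).snd.toInt with hw
  have h20 : (s₀ 20).truth = true := h.started
  have h16 : (s₀ 16).toIntList = D := h.disp D rfl
  set m := D.length + 1 with hm
  have hm' : (0 :: D).length = m := rfl
  have h0 : (Val.pair (.int 0) (s₀ 16)).toIntList = 0 :: D := by simp [Val.toIntList, h16]
  refine Exec.mono
    (n := 7 + (m * 12 + 1 +
      (5 + (m * (walkTime n + 15) + 1 + (m * 4 + 1) + 1) + 1 + 1) + 1) + 1 + 1)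
    (Exec.ite (fun _ => ?_) fun ht => ?_) ?_ fun _ h => h
  rotate_left
  · simp [Expr.eval, h20] at ht
  · unfold respondTime
    rw [← hm, show m * (walkTime n + 31) = m * 12 + m * (walkTime n + 15) + m * 4 by ring]
    omega
  refine Exec.seq (P' := fun s => (s 17).toInt = v ∧ (s 18).toInt = w ∧
    (s 8).toIntList = 0 :: D ∧ (s 9).truth = true ∧ ∀ i, 12 ≤ i → i ≠ 17 → i ≠ 18 → s i = s₀ i)
    (.simple rfl le_rfl ?_) ?_
  · simp only [Cmd.block, Cmd.effect, Expr.eval]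
    refine ⟨by simp [hv], by simp [hw], by simp [h0], by simp [Val.truth], fun i h₁ h₂ h₃ => ?_⟩
    rw [Function.update_of_ne (by omega), Function.update_of_ne (by omega),
      Function.update_of_ne (by omega), Function.update_of_ne (by omega)]
  rintro s₁ ⟨k17, k18, k8, k9, kfr⟩
  refine Exec.seq (exec_check k17 k18 k8 k9 fun _ _ => rfl) ?_
  rintro s₂ ⟨lfr, hl⟩
  have hfr₂ : ∀ i, 12 ≤ i → i ≠ 17 → i ≠ 18 → s₂ i = s₀ i := fun i h₁ h₂ h₃ =>
    (lfr i h₁).trans (kfr i h₁ h₂ h₃)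
  refine Exec.ite (fun ht => ?_) fun ht => ?_
  · have ht : (s₂ 9).truth = true := ht
    replace hl := hl.resolve_right (by simp [ht])
    have l21 : s₂ 21 = Val.ofBool b := (hfr₂ 21 (by omega) (by omega) (by omega)).trans h.bit
    have l12 : s₂ 12 = augVal t := (hfr₂ 12 (by omega) (by omega) (by omega)).trans h.tree
    have l15 : s₂ 15 = pairsVal L := (hfr₂ 15 (by omega) (by omega) (by omega)).trans h.pairs
    have l16 : s₂ 16 = s₀ 16 := hfr₂ 16 (by omega) (by omega) (by omega)
    refine Exec.seq (P' := fun s => (s 13).toIntList = 0 :: D ∧ s 14 = .nil ∧ s 23 = .nil ∧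
      ∀ i, 12 ≤ i → i ≠ 13 → i ≠ 14 → i ≠ 23 → s i = s₂ i) (.simple rfl le_rfl ?_) ?_
    · simp only [Cmd.block, Cmd.effect, Expr.eval]
      refine ⟨by simp [l16, h0], by simp, by simp, fun i h₁ h₂ h₃ h₄ => ?_⟩
      rw [Function.update_of_ne (by omega), Function.update_of_ne (by omega),
        Function.update_of_ne (by omega)]
    rintro s₃ ⟨p13, p14, p23, pfr⟩
    have q : ∀ {i}, 12 ≤ i → i ≠ 13 → i ≠ 14 → i ≠ 23 → s₃ i = s₂ i := fun {i} => pfr i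
    refine Exec.seq (exec_play (D := 0 :: D) (n := n) (v := v) (w := w) (b := b) (t := t)
      (L := L) hn
      (by rw [q (by omega) (by omega) (by omega) (by omega), lfr 17 (by omega), k17])
      (by rw [q (by omega) (by omega) (by omega) (by omega), lfr 18 (by omega), k18])
      ((q (by omega) (by omega) (by omega) (by omega)).trans l21)
      ((q (by omega) (by omega) (by omega) (by omega)).trans l12) p13 p14
      ((q (by omega) (by omega) (by omega) (by omega)).trans l15)) ?_
    rintro s₄ ⟨⟨ys, hys, hρ, r12, r14⟩, r15, rfr⟩
    have hlen : (STree.insertList cmpPt ys t).2.reverse.length = m := by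
      have h₁ : ys.length = m := by simpa using congrArg List.length hys
      have h₂ : ∀ (ys : List (ℤ × Val)) (t : STree (ℤ × Val)),
          (STree.insertList cmpPt ys t).2.length = ys.length := by
        intro ys
        induction ys with
        | nil => intro t; rfl
        | cons y ys ih => intro t; simp [STree.insertList, ih]
      rw [List.length_reverse, h₂, h₁]
    have hrev := exec_reverse (ρ := ρ) itemVal _ (l' := []) r14
      (by rw [rfr 23 (by omega), p23]; rfl)
    rw [hlen] at hrev
    refine hrev.mono le_rfl ?_
    rintro s₅ ⟨u23, ufr⟩
    have hfr₅ : ∀ i, 16 ≤ i → i ≠ 17 → i ≠ 18 → i ≠ 23 → s₅ i = s₀ i := by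
      intro i h₁ h₂ h₃ h₄
      rw [ufr i (by omega) h₄, rfr i h₁, q (by omega) (by omega) (by omega) h₄,
        hfr₂ i (by omega) h₂ h₃]
    refine ⟨fun i hi => hfr₅ i (by omega) (by omega) (by omega) (by omega),
      Or.inr ⟨hl.2, ys, hys, hρ, ⟨?_, ?_, ?_, ?_, ?_⟩, ?_⟩⟩
    · rw [ufr 12 (by omega) (by omega), r12]
    · rw [ufr 15 (by omega) (by omega), r15]
    · rw [hfr₅ 21 (by omega) (by omega) (by omega) (by omega), h.bit]
    · rw [hfr₅ 20 (by omega) (by omega) (by omega) (by omega), h.started]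
    · rintro _ ⟨⟩
      rw [hfr₅ 16 (by omega) (by omega) (by omega) (by omega), h16]
    · rw [u23, List.reverse_reverse, List.append_nil]
      rfl
  · have ht : (s₂ 9).truth = false := ht
    replace hl := hl.resolve_left (by simp [ht])
    refine .simple (c := .assign 23 .nil) rfl (Nat.le_add_left 1 _) ?_
    simp only [Cmd.effect, Expr.eval]
    have hfr₃ : ∀ i, 12 ≤ i → i ≠ 17 → i ≠ 18 → i ≠ 23 →
        Function.update s₂ 23 Val.nil i = s₀ i := fun i h₁ h₂ h₃ h₄ =>
      (Function.update_of_ne h₄ _ _).trans (hfr₂ i h₁ h₂ h₃)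
    refine ⟨fun i hi => hfr₃ i (by omega) (by omega) (by omega) (by omega), Or.inl ⟨hl.2,
      ⟨?_, ?_, ?_, ?_, ?_⟩, by simp⟩⟩
    · rw [hfr₃ 12 (by omega) (by omega) (by omega) (by omega), h.tree]
    · rw [hfr₃ 15 (by omega) (by omega) (by omega) (by omega), h.pairs]
    · rw [hfr₃ 21 (by omega) (by omega) (by omega) (by omega), h.bit]
    · rw [hfr₃ 20 (by omega) (by omega) (by omega) (by omega), h.started]
    · rintro _ ⟨⟩
      rw [hfr₃ 16 (by omega) (by omega) (by omega) (by omega), h16]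

end

section

variable {ρ : Val → Val → Prop} {b : Bool} {L : List (ℤ × ℤ)} {t : STree (ℤ × Val)}

lemma Holds.congr {s₀ s : Store} {disp : Option (List ℤ)} (h : Holds s₀ b disp L t)
    (hs : ∀ i, 12 ≤ i → i < 22 → s i = s₀ i) : Holds s b disp L t :=
  ⟨(hs 12 (by omega) (by omega)).trans h.tree, (hs 15 (by omega) (by omega)).trans h.pairs,
    (hs 21 (by omega) (by omega)).trans h.bit,
    (congrArg _ (hs 20 (by omega) (by omega))).trans h.started,
    fun D hD => (congrArg _ (hs 16 (by omega) (by omega))).trans (h.disp D hD)⟩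

/-- The possible reactions of the challenger to the message `q`: the new displacements, pairs of
values and tree, and the reply. -/
def Reacts (ρ : Val → Val → Prop) (b : Bool) (L : List (ℤ × ℤ)) (t : STree (ℤ × Val)) (q : Val) :
    Option (List ℤ) → Option (List ℤ) → List (ℤ × ℤ) → STree (ℤ × Val) → Val → Prop
  | none, disp', L', t', r => disp' = some q.toIntList ∧ L' = L ∧ t' = t ∧ r = .nil
  | some D, disp', L', t', r => disp' = some D ∧
    (((∃ d ∈ 0 :: D, Refuses ρ (q.fst.toInt + d) ∨ Refuses ρ (q.snd.toInt + d)) ∧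
        L' = L ∧ t' = t ∧ r = .nil) ∨
      ((∀ d ∈ 0 :: D, Accepts ρ (q.fst.toInt + d) ∧ Accepts ρ (q.snd.toInt + d)) ∧
        ∃ ys : List (ℤ × Val),
          ys.map Prod.fst = (0 :: D).map (fun d => side b (q.fst.toInt + d, q.snd.toInt + d)) ∧
          (∀ y ∈ ys, ρ (.int y.1) y.2) ∧
          L' = ((0 :: D).map fun d => (q.fst.toInt + d, q.snd.toInt + d)).reverse ++ L ∧
          t' = (STree.insertList cmpPt ys t).1 ∧
          r = viewOf Prod.snd (STree.insertList cmpPt ys t).2))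

lemma exec_respond {s₀ : Store} {disp : Option (List ℤ)} (h : Holds s₀ b disp L t) {d n : ℕ}
    (hd : ∀ D, disp = some D → D.length ≤ d) (hn : t.size + (d + 1) ≤ n) :
    Exec ρ .respond s₀ (respondTime d n) fun s => ∃ disp' L' t' r,
      Reacts ρ b L t (s₀ 22) disp disp' L' t' r ∧ Holds s b disp' L' t' ∧ s 23 = r ∧
        ∀ i, 24 ≤ i → s i = s₀ i := by
  rcases disp with _ | D
  · refine (exec_respond_none h d n).mono le_rfl fun s ⟨h₁, h₂, h₃⟩ => ?_
    exact ⟨_, _, _, _, ⟨rfl, rfl, rfl, rfl⟩, h₁, h₂, h₃⟩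
  · have hD := hd D rfl
    refine (exec_respond_some h (n := n) (by omega)).mono (respondTime_mono hD le_rfl) ?_
    rintro s ⟨hfr, ⟨h₁, h₂, h₃⟩ | ⟨h₁, ys, h₂, h₃, h₄, h₅⟩⟩
    · exact ⟨_, _, _, _, ⟨rfl, Or.inl ⟨h₁, rfl, rfl, rfl⟩⟩, h₂, h₃, hfr⟩
    · exact ⟨_, _, _, _, ⟨rfl, Or.inr ⟨h₁, ys, h₂, h₃, rfl, rfl, rfl⟩⟩, h₄, h₅, hfr⟩

end

/-! ### The final decision as a program -/

namespace Cmd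

open MOPED.Expr in
/-- Clears register 9 if the pairs that come first in the registers 7 and 8 are not ordered in the
same way on both sides. -/
def compareOne : Cmd :=
  block [ite (le (fst (fst (var 7))) (fst (fst (var 8))))
      (ite (le (snd (fst (var 7))) (snd (fst (var 8)))) skip (assign 9 nil))
      (ite (le (snd (fst (var 7))) (snd (fst (var 8)))) (assign 9 nil) skip),
    assign 7 (snd (var 7))]

open MOPED.Expr in
/-- Compares the pair that comes first in register 8 with all pairs. -/
def compareAll : Cmd :=
  seq (assign 7 (var 15)) (seq (loop (isPair (var 7)) compareOne) (assign 8 (snd (var 8))))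

open MOPED.Expr in
/-- Outputs whether the game was fair and the output of the adversary, in register 32, is the bit
in register 21. -/
def judge : Cmd :=
  seq (block [assign 9 (lit 1), assign 8 (var 15)])
    (seq (loop (isPair (var 8)) compareAll)
      (ite (var 9)
        (ite (var 21) (ite (var 32) (assign 0 (lit 1)) (assign 0 nil))
          (ite (var 32) (assign 0 nil) (assign 0 (lit 1))))
        (assign 0 nil)))

end Cmd

/-- The running time of the final decision about `n` pairs of values. -/
def judgeTime (n : ℕ) : ℕ := n * (n * (Cmd.compareOne.cost + 1) + 10) + 20

lemma judgeTime_mono {m n : ℕ} (h : m ≤ n) : judgeTime m ≤ judgeTime n := by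
  unfold judgeTime; gcongr

section

variable {ρ : Val → Val → Prop}

lemma effect_compareOne {s : Store} {x y : ℤ × ℤ} {u v : Val}
    (h7 : s 7 = .pair (.pair (.int y.1) (.int y.2)) u)
    (h8 : s 8 = .pair (.pair (.int x.1) (.int x.2)) v) :
    Cmd.compareOne.effect s = Function.update
      (if y.1 ≤ x.1 ↔ y.2 ≤ x.2 then s else Function.update s 9 .nil) 7 u := by
  by_cases h₁ : y.1 ≤ x.1 <;> by_cases h₂ : y.2 ≤ x.2 <;>
    simp [Cmd.compareOne, Cmd.block, Cmd.effect, Expr.eval, h7, h8, Val.fst, Val.snd, h₁, h₂,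
      -not_le]

lemma exec_compareOne {x : ℤ × ℤ} {v : Val} (M : List (ℤ × ℤ)) {s₀ : Store}
    (h7 : s₀ 7 = pairsVal M) (h8 : s₀ 8 = .pair (.pair (.int x.1) (.int x.2)) v) :
    Exec ρ (.loop (.isPair (.var 7)) .compareOne) s₀ (M.length * (Cmd.compareOne.cost + 1) + 1)
      fun s => ((s 9).truth = true ↔
        (s₀ 9).truth = true ∧ ∀ y ∈ M, (y.1 ≤ x.1 ↔ y.2 ≤ x.2)) ∧
        ∀ i, i ≠ 7 → i ≠ 9 → s i = s₀ i := by
  refine Exec.loop (fun j s => ∃ F G : List (ℤ × ℤ), G.length = j ∧ F ++ G = M ∧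
    s 7 = pairsVal G ∧ ((s 9).truth = true ↔
        (s₀ 9).truth = true ∧ ∀ y ∈ F, (y.1 ≤ x.1 ↔ y.2 ≤ x.2)) ∧
        ∀ i, i ≠ 7 → i ≠ 9 → s i = s₀ i) ?_ _ _
    ⟨[], M, rfl, rfl, h7, by simp, fun _ _ _ => rfl⟩
  rintro _ s ⟨F, G, rfl, hM, g7, g9, hfr⟩
  rcases G with _ | ⟨y, G⟩
  · rw [List.append_nil] at hM
    subst hM
    exact Or.inl ⟨by simp [Expr.eval, g7, pairsVal, Val.ofList], g9, hfr⟩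
  · refine Or.inr ⟨by simp [Expr.eval, g7, pairsVal, Val.ofList], G.length, by simp,
      .simple rfl le_rfl ⟨F ++ [y], G, rfl, by simp [hM], ?_⟩⟩
    rw [effect_compareOne (x := x) (y := y) g7 ((hfr 8 (by omega) (by omega)).trans h8)]
    refine ⟨by simp [pairsVal], ?_, fun i h₁ h₂ => ?_⟩
    · simp only [List.mem_append, List.mem_singleton, or_imp, forall_and, forall_eq]
      split_ifs with h
      · simp [g9, h]
      · simp [h, Val.truth]
    · rw [Function.update_of_ne h₁]
      split_ifs
      · exact hfr i h₁ h₂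
      · rw [Function.update_of_ne h₂, hfr i h₁ h₂]

lemma exec_judge {b : Bool} {L : List (ℤ × ℤ)} {s₀ : Store} (h15 : s₀ 15 = pairsVal L)
    (h21 : s₀ 21 = Val.ofBool b) :
    Exec ρ .judge s₀ (judgeTime L.length) fun s =>
      (s 0).truth = true ↔ (s₀ 32).truth = b ∧ OrderAgree L := by
  refine Exec.mono (n := 3 + ((L.length * ((1 + (L.length * (Cmd.compareOne.cost + 1) + 1 + 1 + 1) +
    1) + 1) + 1) + 4 + 1) + 1) (Exec.seq (P' := fun s => s 8 = pairsVal L ∧ (s 9).truth = true ∧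
      ∀ i, 10 ≤ i → s i = s₀ i) (.simple rfl le_rfl ?_) ?_) ?_ fun _ h => h
  · simp only [Cmd.block, Cmd.effect, Expr.eval]
    refine ⟨by simp [h15], by simp [Val.truth], fun i hi => ?_⟩
    rw [Function.update_of_ne (by omega), Function.update_of_ne (by omega)]
  rotate_left
  · unfold judgeTime
    have : L.length * ((1 + (L.length * (Cmd.compareOne.cost + 1) + 1 + 1 + 1) + 1) + 1) ≤
        L.length * (L.length * (Cmd.compareOne.cost + 1) + 10) :=
      Nat.mul_le_mul_left _ (by omega)
    omega
  rintro s₁ ⟨k8, k9, kfr⟩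
  refine Exec.seq (n₁ := L.length *
      ((1 + (L.length * (Cmd.compareOne.cost + 1) + 1 + 1 + 1) + 1) + 1) + 1) (n₂ := 4)
    (P' := fun s => ((s 9).truth = true ↔ OrderAgree L) ∧
    ∀ i, 10 ≤ i → s i = s₀ i) (Exec.loop (fun j s => ∃ F G : List (ℤ × ℤ), G.length = j ∧
      F ++ G = L ∧ s 8 = pairsVal G ∧
      ((s 9).truth = true ↔ ∀ x ∈ F, ∀ y ∈ L, (y.1 ≤ x.1 ↔ y.2 ≤ x.2)) ∧
      ∀ i, 10 ≤ i → s i = s₀ i) ?_ _ _ ⟨[], L, rfl, rfl, k8, by simp [k9], kfr⟩) ?_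
  · rintro _ s ⟨F, G, rfl, hL, g8, g9, hfr⟩
    rcases G with _ | ⟨x, G⟩
    · rw [List.append_nil] at hL
      subst hL
      exact Or.inl ⟨by simp [Expr.eval, g8, pairsVal, Val.ofList], g9, hfr⟩
    · refine Or.inr ⟨by simp [Expr.eval, g8, pairsVal, Val.ofList], G.length, by simp, ?_⟩
      refine Exec.seq (P' := fun s' => s' = Function.update s 7 (pairsVal L))
        (.simple rfl le_rfl ?_) ?_
      · simp only [Cmd.effect, Expr.eval]
        rw [hfr 15 (by omega), h15]
      rintro _ rfl
      refine Exec.seq (n₁ := L.length * (Cmd.compareOne.cost + 1) + 1) (n₂ := 1)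
        (exec_compareOne (s₀ := Function.update s 7 (pairsVal L)) (x := x) (v := pairsVal G) L
          (by simp) (by rw [Function.update_of_ne (by omega), g8]; rfl)) ?_
      rintro s' ⟨h9, hfr'⟩
      refine .simple rfl le_rfl ⟨F ++ [x], G, rfl, by simp [hL], ?_, ?_, fun i hi => ?_⟩
      · simp only [Cmd.effect, Expr.eval, Function.update_self]
        rw [hfr' 8 (by omega) (by omega), Function.update_of_ne (by omega), g8]
        rfl
      · simp only [Cmd.effect]
        rw [Function.update_of_ne (by omega), h9, Function.update_of_ne (by omega), g9]
        simp only [List.mem_append, List.mem_singleton, or_imp, forall_and, forall_eq]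
      · simp only [Cmd.effect]
        rw [Function.update_of_ne (by omega), hfr' i (by omega) (by omega),
          Function.update_of_ne (by omega), hfr i hi]
  · rintro s ⟨h9, hfr⟩
    refine .simple rfl le_rfl ?_
    have e21 : s 21 = Val.ofBool b := (hfr 21 (by omega)).trans h21
    have e32 : s 32 = s₀ 32 := hfr 32 (by omega)
    rw [← h9]
    cases h : (s 9).truth <;> cases h' : (s₀ 32).truth <;> cases b <;>
      simp [Cmd.effect, Expr.eval, e21, e32, h, h', Val.ofBool]

end

/-! ### The distinguisher -/

/-- Renaming the registers, so that the registers below 32 are free. -/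
def Expr.shift : Expr → Expr
  | var x => var (x + 32)
  | nil => nil
  | lit z => lit z
  | pair e₁ e₂ => pair e₁.shift e₂.shift
  | fst e => fst e.shift
  | snd e => snd e.shift
  | add e₁ e₂ => add e₁.shift e₂.shift
  | sub e₁ e₂ => sub e₁.shift e₂.shift
  | le e₁ e₂ => le e₁.shift e₂.shift
  | isInt e => isInt e.shift
  | isPair e => isPair e.shift

lemma Expr.eval_shift {s sA : Store} (h : ∀ x, s (x + 32) = sA x) (e : Expr) :
    e.shift.eval s = e.eval sA := by
  induction e with
  | var x => exact h x
  | nil => rfl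
  | lit z => rfl
  | pair e₁ e₂ ih₁ ih₂ => simp only [shift, eval, ih₁, ih₂]
  | fst e ih => simp only [shift, eval, ih]
  | snd e ih => simp only [shift, eval, ih]
  | add e₁ e₂ ih₁ ih₂ => simp only [shift, eval, ih₁, ih₂]
  | sub e₁ e₂ ih₁ ih₂ => simp only [shift, eval, ih₁, ih₂]
  | le e₁ e₂ ih₁ ih₂ => simp only [shift, eval, ih₁, ih₂]
  | isInt e ih => simp only [shift, eval, ih]
  | isPair e ih => simp only [shift, eval, ih]

/-- The program of the adversary in shifted registers, where the challenger is simulated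
whenever a message is sent. -/
def Cmd.compile : Cmd → Cmd
  | skip => skip
  | assign x e => assign (x + 32) e.shift
  | seq c₁ c₂ => seq c₁.compile c₂.compile
  | ite e c₁ c₂ => ite e.shift c₁.compile c₂.compile
  | loop e c => loop e.shift c.compile
  | toss x => toss (x + 32)
  | send x e => seq (assign 22 e.shift) (seq respond (assign (x + 32) (.var 23)))

/-- The distinguisher: it tosses the bit, plays the game with the adversary, encrypting by means of
its oracle, and outputs whether the adversary wins. -/
def Cmd.distinguisher (p : Cmd) : Cmd :=
  seq (assign 32 (.var 0)) (seq (toss 21) (seq p.compile judge))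

/-- The nesting depth of data. -/
def Val.depth : Val → ℕ
  | pair a b => max a.depth b.depth + 1
  | _ => 0

/-- The size of an expression. -/
def Expr.size : Expr → ℕ
  | pair e₁ e₂ => e₁.size + e₂.size + 1
  | fst e => e.size
  | snd e => e.size
  | _ => 0

/-- The maximal size of an expression in a command. -/
def Cmd.width : Cmd → ℕ
  | assign _ e => e.size
  | seq c₁ c₂ => max c₁.width c₂.width
  | ite _ c₁ c₂ => max c₁.width c₂.width
  | loop _ c => c.width
  | send _ e => e.size
  | _ => 0

lemma Val.depth_ofBool (b : Bool) : (Val.ofBool b).depth = 0 := by cases b <;> rfl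

lemma Expr.depth_eval_le {s : Store} {M : ℕ} (h : ∀ x, (s x).depth ≤ M) (e : Expr) :
    (e.eval s).depth ≤ M + e.size := by
  induction e with
  | var x => exact h x
  | pair e₁ e₂ ih₁ ih₂ => simp only [eval, size, Val.depth]; omega
  | fst e ih =>
    simp only [eval, size]
    cases he : e.eval s <;> simp_all [Val.fst, Val.depth]
    omega
  | snd e ih =>
    simp only [eval, size]
    cases he : e.eval s <;> simp_all [Val.snd, Val.depth]
    omega
  | le e₁ e₂ => simp [eval, Val.depth_ofBool]
  | isInt e => simp only [eval]; split <;> simp [Val.depth_ofBool]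
  | isPair e => simp only [eval]; split <;> simp [Val.depth_ofBool]
  | _ => simp [eval, Val.depth]

lemma Val.length_toIntList_le (v : Val) : v.toIntList.length ≤ v.depth := by
  induction v with
  | pair a b _ ih => simp only [toIntList, depth, List.length_cons]; omega
  | _ => simp [toIntList]

lemma Config.todo_eq_nil {k : List Cmd} {s : Store}
    (h : Config.next ⟨k, s⟩ = Action.halt) : k = [] := by
  rcases k with _ | ⟨c, k⟩
  · rfl
  · cases c <;> simp [Config.next] at h

section

variable {ρ : Val → Val → Prop} {b : Bool} {disp : Option (List ℤ)} {L : List (ℤ × ℤ)}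
  {t : STree (ℤ × Val)} {s sA : Store}

lemma Holds.update (h : Holds s b disp L t) (x : ℕ) (v : Val) :
    Holds (Function.update s (x + 32) v) b disp L t :=
  h.congr fun i _ _ => Function.update_of_ne (by omega) _ _

lemma update_shift (hs : ∀ x, s (x + 32) = sA x) (x : ℕ) (v : Val) (i : ℕ) :
    Function.update s (x + 32) v (i + 32) = Function.update sA x v i := by
  by_cases h : i = x
  · subst h; simp
  · rw [Function.update_of_ne (by omega), Function.update_of_ne h, hs]

lemma exec_compile_send (h : Holds s b disp L t) (hs : ∀ x, s (x + 32) = sA x) {d n : ℕ}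
    (hd : ∀ D, disp = some D → D.length ≤ d) (hn : t.size + (d + 1) ≤ n) (x : ℕ) (e : Expr) :
    Exec ρ (Cmd.send x e).compile s (respondTime d n + 4) fun s' => ∃ disp' L' t' r,
      Reacts ρ b L t (e.eval sA) disp disp' L' t' r ∧ Holds s' b disp' L' t' ∧
        ∀ i, s' (i + 32) = Function.update sA x r i := by
  refine Exec.mono (n := 1 + (respondTime d n + 1 + 1) + 1)
    (Exec.seq (P' := fun s' => s' = Function.update s 22 (e.eval sA)) (.simple rfl le_rfl ?_) ?_)
    (by omega) fun _ h => h
  · simp only [Cmd.effect, Expr.eval_shift hs]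
  rintro _ rfl
  refine Exec.seq (exec_respond (s₀ := Function.update s 22 (e.eval sA))
    (h.congr fun i _ _ => Function.update_of_ne (by omega) _ _) hd hn) ?_
  rintro s₁ ⟨disp', L', t', r, h₁, h₂, h₃, h₄⟩
  rw [Function.update_self] at h₁
  refine .simple rfl le_rfl ⟨disp', L', t', r, h₁, h₂.update _ _, fun i => ?_⟩
  simp only [Cmd.effect, Expr.eval, h₃]
  refine update_shift (fun i => ?_) x r i
  rw [h₄ _ (by omega), Function.update_of_ne (by omega), hs]

/-- What a reaction of the challenger adds to its state. -/
lemma Reacts.bounds {q : Val} {disp' : Option (List ℤ)} {L' : List (ℤ × ℤ)}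
    {t' : STree (ℤ × Val)} {r : Val} (h : Reacts ρ b L t q disp disp' L' t' r) {d : ℕ}
    (hd : ∀ D, disp = some D → D.length ≤ d) (hq : disp = none → q.depth ≤ d) :
    (∃ D, disp' = some D ∧ D.length ≤ d) ∧ L'.length ≤ L.length + (d + 1) ∧
      t'.size ≤ t.size + (d + 1) := by
  rcases disp with _ | D
  · obtain ⟨h₁, h₂, h₃, -⟩ := h
    exact ⟨⟨_, h₁, q.length_toIntList_le.trans (hq rfl)⟩, by rw [h₂]; omega, by rw [h₃]; omega⟩
  · have hD := hd D rfl
    obtain ⟨h₀, ⟨-, h₂, h₃, -⟩ | ⟨-, ys, hys, -, h₂, h₃, -⟩⟩ := h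
    · exact ⟨⟨D, h₀, hD⟩, by rw [h₂]; omega, by rw [h₃]; omega⟩
    · have hlen : ys.length = D.length + 1 := by simpa using congrArg List.length hys
      have := STree.size_insertList_le cmpPt ys t
      refine ⟨⟨D, h₀, hD⟩, ?_, by rw [h₃]; omega⟩
      rw [h₂]
      simp only [List.length_append, List.length_reverse, List.length_map, List.length_cons]
      omega

/-- The simulation halts in time: one step of the adversary takes one step, or the time of one
reply.  The bound `d` on the number of displacements comes from the depth of the data that the
adversary can build before its first message. -/
lemma haltsWithin_compile {d N K : ℕ} (n : ℕ) (k : List Cmd) (hk : ∀ c ∈ k, c.width ≤ K)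
    (hA : Config.HaltsWithin n ⟨k, sA⟩) (h : Holds s b disp L t) (hs : ∀ x, s (x + 32) = sA x)
    (hd : ∀ D, disp = some D → D.length ≤ d)
    (hM : disp = none → ∃ M, (∀ x, (sA x).depth ≤ M) ∧ M + n * K ≤ d)
    (hL : L.length + n * (d + 1) ≤ N) (ht : t.size + n * (d + 1) ≤ N) :
    Config.HaltsWithin (n * (respondTime d N + 4) + judgeTime N)
      ⟨k.map Cmd.compile ++ [Cmd.judge], s⟩ := by
  have hnil : ∀ {L : List (ℤ × ℤ)} {disp : Option (List ℤ)} {t : STree (ℤ × Val)} {s : Store}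
      (m : ℕ), Holds s b disp L t → L.length ≤ N →
      Config.HaltsWithin (m + judgeTime N) ⟨[].map Cmd.compile ++ [Cmd.judge], s⟩ := by
    intro L disp t s m h hL
    refine Config.HaltsWithin.mono (show judgeTime N + 0 + 0 ≤ m + judgeTime N by omega)
      (Steps.haltsWithin ?_)
    exact (exec_judge h.pairs h.bit).mono (judgeTime_mono hL) (fun _ h => h) [] 0 _ fun _ _ => rfl
  induction n generalizing k sA s disp L t with
  | zero =>
    obtain rfl := Config.todo_eq_nil hA
    exact hnil _ h (by omega)
  | succ n ih =>
    rcases k with _ | ⟨c, k⟩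
    · exact hnil _ h (by omega)
    have hc : c.width ≤ K := hk c (by simp)
    have hk' : ∀ c ∈ k, c.width ≤ K := fun c hc => hk c (by simp [hc])
    have hsucc : ∀ a : ℕ, (n + 1) * a = n * a + a := fun a => Nat.succ_mul n a
    rw [hsucc] at hL ht
    have hM' : disp = none → ∃ M, (∀ x, (sA x).depth ≤ M) ∧ M + n * K ≤ d := fun hn => by
      obtain ⟨M, h₁, h₂⟩ := hM hn
      exact ⟨M, h₁, by rw [hsucc] at h₂; omega⟩
    -- Commands other than messages take one step in the simulation, too.
    have htau : ∀ {c' : Config}, Config.next ⟨(c :: k).map Cmd.compile ++ [Cmd.judge], s⟩ =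
        Action.tau c' → Config.HaltsWithin (n * (respondTime d N + 4) + judgeTime N) c' →
        Config.HaltsWithin ((n + 1) * (respondTime d N + 4) + judgeTime N)
          ⟨(c :: k).map Cmd.compile ++ [Cmd.judge], s⟩ := by
      intro c' hn hc'
      refine Config.HaltsWithin.mono (n := n * (respondTime d N + 4) + judgeTime N + 1)
        (by rw [hsucc]; omega) ?_
      rw [Config.HaltsWithin, hn]
      exact hc'
    cases c with
    | skip => exact htau rfl (ih k hk' hA h hs hd hM' (by omega) (by omega))
    | assign x e =>
      refine htau rfl (ih k hk' hA (h.update x _)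
        (by rw [Expr.eval_shift hs]; exact update_shift hs x _) hd (fun hn => ?_) (by omega)
        (by omega))
      obtain ⟨M, h₁, h₂⟩ := hM hn
      have hc : e.size ≤ K := hc
      refine ⟨M + K, fun y => ?_, by rw [hsucc] at h₂; omega⟩
      by_cases hy : y = x
      · subst hy
        rw [Function.update_self]
        exact (Expr.depth_eval_le h₁ e).trans (by omega)
      · rw [Function.update_of_ne hy]
        exact (h₁ y).trans (by omega)
    | seq c₁ c₂ =>
      simp only [Cmd.width] at hc
      refine htau rfl (ih (c₁ :: c₂ :: k) ?_ hA h hs hd hM' (by omega) (by omega))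
      simp only [List.mem_cons, forall_eq_or_imp]
      exact ⟨by omega, by omega, hk'⟩
    | ite e c₁ c₂ =>
      simp only [Cmd.width] at hc
      refine htau rfl ?_
      have := ih ((if (e.eval sA).truth then c₁ else c₂) :: k) ?_ hA h hs hd hM' (by omega)
        (by omega)
      · rw [Expr.eval_shift hs]
        cases he : (e.eval sA).truth <;> simpa [he] using this
      · simp only [List.mem_cons, forall_eq_or_imp]
        refine ⟨?_, hk'⟩
        split_ifs <;> omega
    | loop e c =>
      refine htau rfl ?_
      have := ih (if (e.eval sA).truth then c :: .loop e c :: k else k) ?_ hA h hs hd hM'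
        (by omega) (by omega)
      · rw [Expr.eval_shift hs]
        cases he : (e.eval sA).truth
        · simpa [he] using this
        · simpa [he, Cmd.compile] using this
      · intro c' hc'
        split_ifs at hc'
        · rcases List.mem_cons.1 hc' with rfl | hc'
          · exact hc
          rcases List.mem_cons.1 hc' with rfl | hc'
          · exact hc
          exact hk' _ hc'
        · exact hk' _ hc'
    | toss x =>
      refine Config.HaltsWithin.mono (n := n * (respondTime d N + 4) + judgeTime N + 1)
        (by rw [hsucc]; omega) ?_
      refine fun a => ih k hk' (hA a) (h.update x _) (update_shift hs x _) hd (fun hn => ?_)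
        (by omega) (by omega)
      obtain ⟨M, h₁, h₂⟩ := hM' hn
      refine ⟨M, fun y => ?_, h₂⟩
      by_cases hy : y = x
      · subst hy
        rw [Function.update_self, Val.depth_ofBool]
        exact Nat.zero_le _
      · rw [Function.update_of_ne hy]
        exact h₁ y
    | send x e =>
      have hq : disp = none → (e.eval sA).depth ≤ d := fun hn => by
        obtain ⟨M, h₁, h₂⟩ := hM hn
        have hc : e.size ≤ K := hc
        rw [hsucc] at h₂
        exact (Expr.depth_eval_le h₁ e).trans (by omega)
      refine Config.HaltsWithin.mono (show respondTime d N + 4 +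
        (n * (respondTime d N + 4) + judgeTime N) + 0 ≤ _ by rw [hsucc]; omega) ?_
      have hex := exec_compile_send (ρ := fun _ _ => True) h hs (n := N) hd (by omega) x e
      refine Steps.haltsWithin (m := n * (respondTime d N + 4) + judgeTime N)
        (hex (k.map Cmd.compile ++ [Cmd.judge]) 0 _ ?_)
      rintro s' ⟨disp', L', t', r, hr, h', hs'⟩
      obtain ⟨⟨D, hD, hDd⟩, hL', ht'⟩ := hr.bounds hd hq
      refine ih k hk' (hA r) h' hs' ?_ ?_ (by omega) (by omega)
      · intro D' hD'
        obtain rfl : D = D' := by simpa [hD] using hD'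
        exact hDd
      · intro hn
        simp [hD] at hn

end

/-! ### The distinguisher simulates the game -/

lemma compare_msgInt {n : ℕ} (a b : Fin (2 ^ n)) : compare (msgInt a) (msgInt b) = compare a b := by
  rcases lt_trichotomy a b with h | h | h
  · rw [compare_lt_iff_lt.2 h, compare_lt_iff_lt, ← not_le, DetEncScheme.msgInt_le, not_le]
    exact h
  · rw [h, compare_eq_iff_eq.2 rfl, compare_eq_iff_eq.2 rfl]
  · rw [compare_gt_iff_gt.2 h, compare_gt_iff_gt, ← not_le, DetEncScheme.msgInt_le,
      not_le]
    exact h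

namespace DetEncScheme

variable (E : DetEncScheme) {κ : ℕ}

/-- The data kept by the simulated challenger for a pair of plaintexts: the plaintext on the side
of the bit, and its encryption. -/
def entry (f : E.Pt κ → E.Ct κ) (b : Bool) (p : E.Pt κ × E.Pt κ) : ℤ × Val :=
  (msgInt (side b p), .int (msgInt (f (side b p))))

/-- The answers of the oracle for `f`. -/
def oracleRel (f : E.Pt κ → E.Ct κ) (q r : Val) : Prop := r = (funOracle f () q).1

lemma accepts_oracleRel {f : E.Pt κ → E.Ct κ} {z : ℤ} (h : Accepts (E.oracleRel f) z) :
    toMsg (E.msgLen κ) z ≠ none := by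
  rintro hz
  obtain ⟨r, rfl, hr⟩ := h
  simp [funOracle, hz] at hr

lemma refuses_oracleRel {f : E.Pt κ → E.Ct κ} {z : ℤ} (h : Refuses (E.oracleRel f) z) :
    toMsg (E.msgLen κ) z = none := by
  obtain ⟨r, rfl, hr⟩ := h
  rcases hz : toMsg (E.msgLen κ) z with _ | m
  · rfl
  · simp [funOracle, hz] at hr

/-- With an oracle for `f`, the simulated challenger reacts as the challenger on pairs. -/
lemma reacts_oracleRel {f : E.Pt κ → E.Ct κ} {b : Bool} {g : GameState (E.Pt κ × E.Pt κ)} {q : Val}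
    {L L' : List (ℤ × ℤ)} {disp' : Option (List ℤ)} {t' : STree (ℤ × Val)} {r : Val}
    (hL : ∀ x, x ∈ L ↔ x ∈ g.pairs) (hg : g.disp = none → g.rounds = [])
    (h : Reacts (E.oracleRel f) b L (g.tree.map (E.entry f b)) q g.disp disp' L' t' r) :
    r = (E.funChallenger f b g q).1 ∧ disp' = (E.funChallenger f b g q).2.disp ∧
      t' = (E.funChallenger f b g q).2.tree.map (E.entry f b) ∧
      (∀ x, x ∈ L' ↔ x ∈ (E.funChallenger f b g q).2.pairs) ∧
      ((E.funChallenger f b g q).2.disp = none → (E.funChallenger f b g q).2.rounds = []) := by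
  obtain ⟨disp, rounds, tree⟩ := g
  rcases disp with _ | D
  · obtain rfl : rounds = [] := hg rfl
    obtain ⟨h₁, h₂, h₃, h₄⟩ := h
    exact ⟨h₄, h₁, h₃, h₂ ▸ hL, fun _ => rfl⟩
  obtain ⟨h₀, h⟩ := h
  rcases h with ⟨⟨d, hd, h₁⟩, rfl, rfl, rfl⟩ | ⟨h₁, ys, hys, hρ, rfl, rfl, rfl⟩
  · have hc : E.funChallenger f b ⟨some D, rounds, tree⟩ q =
        (.nil, ⟨some D, rounds, tree⟩) := by
      have hnone : E.values κ D q.fst.toInt = none ∨ E.values κ D q.snd.toInt = none := by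
        simp only [values_eq, mapM_toMsg_eq_none, shifts]
        exact h₁.imp (fun h => ⟨_, List.mem_map_of_mem hd, E.refuses_oracleRel h⟩)
          fun h => ⟨_, List.mem_map_of_mem hd, E.refuses_oracleRel h⟩
      rcases hnone with h | h <;> simp [funChallenger, pairChallenger, h]
    rw [hc]
    exact ⟨rfl, h₀, rfl, hL, nofun⟩
  · rcases hm₀ : E.values κ D q.fst.toInt with _ | m₀
    · rw [values_eq, mapM_toMsg_eq_none] at hm₀
      obtain ⟨z, hz, hz'⟩ := hm₀
      obtain ⟨d, hd, rfl⟩ := List.mem_map.1 hz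
      exact (E.accepts_oracleRel (h₁ d hd).1 hz').elim
    rcases hm₁ : E.values κ D q.snd.toInt with _ | m₁
    · rw [values_eq, mapM_toMsg_eq_none] at hm₁
      obtain ⟨z, hz, hz'⟩ := hm₁
      obtain ⟨d, hd, rfl⟩ := List.mem_map.1 hz
      exact (E.accepts_oracleRel (h₁ d hd).2 hz').elim
    have hc : E.funChallenger f b ⟨some D, rounds, tree⟩ q =
        (viewOf ((fun m => Val.int (msgInt (f m))) ∘ side b)
          (STree.insertList (cmpSide b) (m₀.zip m₁) tree).2,
        ⟨some D, rounds ++ [(q.fst.toInt, q.snd.toInt)],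
          (STree.insertList (cmpSide b) (m₀.zip m₁) tree).1⟩) := by
      simp [funChallenger, pairChallenger, hm₀, hm₁]
    have hys' : ys = (m₀.zip m₁).map (E.entry f b) := by
      have h₁ : ys = (ys.map Prod.fst).map fun z => (z, (funOracle f () (.int z)).1) := by
        rw [List.map_map]
        refine (List.map_id ys).symm.trans (List.map_congr_left fun y hy => ?_)
        exact Prod.ext rfl (hρ y hy)
      have h₂ : (0 :: D).map (fun d => side b (q.fst.toInt + d, q.snd.toInt + d)) =
          (m₀.zip m₁).map (msgInt ∘ side b) := by
        have := congrArg (List.map (side b)) (E.zip_map_msgInt hm₀ hm₁)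
        rw [List.map_map, List.map_map] at this
        refine Eq.trans this.symm (List.map_congr_left fun p _ => ?_)
        cases b <;> rfl
      rw [h₁, hys, h₂, List.map_map]
      refine List.map_congr_left fun p _ => ?_
      simp only [entry, funOracle, Function.comp_apply, toMsg_msgInt]
      rfl
    have hins := STree.insertList_map (E.entry f b) (cmpSide b) cmpPt
      (fun x y => compare_msgInt _ _) (m₀.zip m₁) tree
    rw [hc, hys', hins]
    refine ⟨?_, h₀, rfl, fun x => ?_, nofun⟩
    · rw [viewOf_mapRecord]
      rfl
    · have hx := hL x
      simp only [GameState.pairs] at hx ⊢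
      simp only [List.mem_append, List.mem_reverse, hx, List.flatMap_append]
      rw [or_comm]
      simp

open Classical in
/-- The simulation computes the result of the game. -/
lemma outputs_compile (f : E.Pt κ → E.Ct κ) (b : Bool) (n : ℕ) (k : List Cmd) {s sA : Store}
    {L : List (ℤ × ℤ)} {g : GameState (E.Pt κ × E.Pt κ)}
    (hA : Config.HaltsWithin n ⟨k, sA⟩) (h : Holds s b g.disp L (g.tree.map (E.entry f b)))
    (hs : ∀ x, s (x + 32) = sA x) (hL : ∀ x, x ∈ L ↔ x ∈ g.pairs)
    (hg : g.disp = none → g.rounds = []) :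
    Outputs (funOracle f) ⟨k.map Cmd.compile ++ [Cmd.judge], s⟩
      ((Config.run (E.funChallenger f b) n ⟨k, sA⟩ g).map fun o =>
        decide (o.1 = b ∧ o.2.Fair)) := by
  have hnil : ∀ {s sA : Store} {L : List (ℤ × ℤ)} {g : GameState (E.Pt κ × E.Pt κ)},
      Holds s b g.disp L (g.tree.map (E.entry f b)) → (∀ x, s (x + 32) = sA x) →
      (∀ x, x ∈ L ↔ x ∈ g.pairs) →
      Outputs (funOracle f) ⟨[].map Cmd.compile ++ [Cmd.judge], s⟩
        (PMF.pure (decide ((sA 0).truth = b ∧ g.Fair))) := by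
    intro s sA L g h hs hL
    refine Outputs.of_steps (exec_judge (ρ := E.oracleRel f) h.pairs h.bit [] 0 _ fun s' hs' => ?_)
    have hfair : g.Fair ↔ OrderAgree L := by
      rw [GameState.fair_iff]
      simp only [OrderAgree, hL]
    have : decide ((sA 0).truth = b ∧ g.Fair) = (s' 0).truth := by
      rw [← hs 0, hfair, Bool.eq_iff_iff, decide_eq_true_eq]
      exact hs'.symm
    rw [this]
    exact Outputs.halt rfl
  induction n generalizing k s sA L g with
  | zero =>
    obtain rfl := Config.todo_eq_nil hA
    simpa only [Config.run, PMF.pure_map] using hnil h hs hL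
  | succ n ih =>
    rcases k with _ | ⟨c, k⟩
    · simpa only [Config.run, Config.next, PMF.pure_map] using hnil h hs hL
    cases c with
    | skip => exact Outputs.tau rfl (ih k hA h hs hL hg)
    | assign x e =>
      exact Outputs.tau rfl (ih k hA (h.update x _)
        (by rw [Expr.eval_shift hs]; exact update_shift hs x _) hL hg)
    | seq c₁ c₂ => exact Outputs.tau rfl (ih (c₁ :: c₂ :: k) hA h hs hL hg)
    | ite e c₁ c₂ =>
      refine Outputs.tau rfl ?_
      have := ih _ hA h hs hL hg
      rw [Expr.eval_shift hs]
      simp only [Config.run, Config.next]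
      cases he : (e.eval sA).truth <;> simpa [he] using this
    | loop e c =>
      refine Outputs.tau rfl ?_
      have := ih _ hA h hs hL hg
      rw [Expr.eval_shift hs]
      simp only [Config.run, Config.next]
      cases he : (e.eval sA).truth <;> simpa [he, Cmd.compile] using this
    | toss x =>
      simp only [Config.run, Config.next, PMF.map_bind]
      exact Outputs.toss rfl fun a => ih k (hA a) (h.update x _) (update_shift hs x _) hL hg
    | send x e =>
      simp only [Config.run, Config.next]
      have hex := exec_compile_send (ρ := E.oracleRel f) h hs
        (d := (g.disp.getD []).length) (fun D hD => by simp [hD]) le_rfl x e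
      refine Outputs.of_steps (hex (k.map Cmd.compile ++ [Cmd.judge]) 0 _ ?_)
      rintro s' ⟨disp', L', t', r, hr, h', hs'⟩
      obtain ⟨rfl, rfl, rfl, hL', hg'⟩ := E.reacts_oracleRel hL hg hr
      exact ih k (hA _) h' hs' hL' hg'

end DetEncScheme

/-- The registers after the initial commands of the distinguisher. -/
def initStore (κ : ℕ) (b : Bool) : Store :=
  Function.update (Function.update (Cmd.start .skip κ).store 32 (.int κ)) 21 (Val.ofBool b)

lemma holds_initStore (κ : ℕ) (b : Bool) : Holds (initStore κ b) b none [] .leaf :=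
  ⟨by simp [initStore, Cmd.start, augVal], by simp [initStore, Cmd.start, pairsVal, Val.ofList],
    by simp [initStore], by simp [initStore, Cmd.start], nofun⟩

lemma initStore_shift (p : Cmd) (κ : ℕ) (b : Bool) (x : ℕ) :
    initStore κ b (x + 32) = (p.start κ).store x := by
  rcases x with _ | x
  · simp [initStore, Cmd.start]
  · rw [initStore, Function.update_of_ne (by omega), Function.update_of_ne (by omega)]
    simp [Cmd.start]

/-- A polynomial bound for the running time of the distinguisher. -/
noncomputable def timePolynomial (T : Polynomial ℕ) (K : ℕ) : Polynomial ℕ :=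
  let d := T * Polynomial.C K
  let n := T * (d + 1)
  T * ((d + 1) * ((n * Polynomial.C (Cmd.walkDown.cost + Cmd.walkUp.cost + 2) + 30) + 31) + 30 + 4)
    + (n * (n * Polynomial.C (Cmd.compareOne.cost + 1) + 10) + 20) + 5

lemma eval_timePolynomial (T : Polynomial ℕ) (K κ : ℕ) :
    (timePolynomial T K).eval κ =
      T.eval κ * (respondTime (T.eval κ * K) (T.eval κ * (T.eval κ * K + 1)) + 4) +
        judgeTime (T.eval κ * (T.eval κ * K + 1)) + 5 := by
  simp only [timePolynomial, respondTime, judgeTime, walkTime, Polynomial.eval_add,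
    Polynomial.eval_mul, Polynomial.eval_C, Polynomial.eval_one, Polynomial.eval_ofNat]

lemma haltsWithin_start_distinguisher {n : ℕ} {p : Cmd} {κ : ℕ}
    (h : ∀ b, Config.HaltsWithin n ⟨[p].map Cmd.compile ++ [Cmd.judge], initStore κ b⟩) :
    (p.distinguisher.start κ).HaltsWithin (n + 5) :=
  fun b => h b

lemma haltsWithin_distinguisher (A : PPT) (κ : ℕ) :
    (A.prog.distinguisher.start κ).HaltsWithin
      ((timePolynomial A.time A.prog.width).eval κ) := by
  rw [eval_timePolynomial]
  refine haltsWithin_start_distinguisher fun b => ?_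
  refine haltsWithin_compile (sA := (A.prog.start κ).store) (K := A.prog.width) (A.time.eval κ)
    [A.prog] (by simp) (A.halts κ) (holds_initStore κ b) (initStore_shift A.prog κ b) nofun
    (fun _ => ⟨0, fun x => ?_, by simp⟩) (by simp) (by simp [STree.size])
  simp only [Cmd.start]
  split_ifs <;> simp [Val.depth]

/-- The distinguisher that plays the game with the adversary `A`. -/
noncomputable def PPT.distinguisher (A : PPT) : PPT :=
  ⟨A.prog.distinguisher, timePolynomial A.time A.prog.width, haltsWithin_distinguisher A⟩

namespace DetEncScheme

variable (E : DetEncScheme) {κ : ℕ}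

/-- With oracle access to `f`, the distinguisher outputs `1` if and only if the adversary wins the
game in which plaintexts are encrypted with `f`. -/
lemma run_distinguisher (A : PPT) (f : E.Pt κ → E.Ct κ) :
    (A.distinguisher.run κ (funOracle f) ()).map Prod.fst = E.funGame A f := by
  classical
  refine Outputs.run_eq ?_ (A.distinguisher.halts κ)
  refine Outputs.tau rfl (Outputs.tau rfl (Outputs.tau rfl (Outputs.toss rfl fun b =>
    Outputs.tau rfl ?_)))
  exact E.outputs_compile f b (A.time.eval κ) [A.prog] (sA := (A.prog.start κ).store)
    (g := GameState.start _) (A.halts κ) (holds_initStore κ b) (initStore_shift A.prog κ b)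
    (by simp [GameState.pairs, GameState.start]) fun _ => rfl

lemma prReal_distinguisher (A : PPT) (κ : ℕ) :
    E.prReal A.distinguisher κ = E.winProb A κ := by
  unfold prReal winProb
  rw [game_eq]
  simp only [run_distinguisher]
  rfl

lemma prIdeal_distinguisher_le (A : PPT) (κ : ℕ) : E.prIdeal A.distinguisher κ ≤ 1 / 2 := by
  unfold prIdeal
  simp only [run_distinguisher]
  have h := E.uniform_funGame_le A κ
  have := ENNReal.toReal_mono (by simp) h
  simpa using this

end DetEncScheme

end MOPED

theorem theorem1 (E : DetEncScheme) (hE : E.IsPRF) :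
    ∀ A : PPT, ∃ negl : ℕ → ℝ, Negligible negl ∧
      ∀ κ : ℕ, E.winProb A κ ≤ 1 / 2 + negl κ := by
  intro A
  refine ⟨_, hE A.distinguisher, fun κ => ?_⟩
  have h₁ := E.prReal_distinguisher A κ
  have h₂ := E.prIdeal_distinguisher_le A κ
  have h₃ := le_abs_self (E.prReal A.distinguisher κ - E.prIdeal A.distinguisher κ)
  linarith
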